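/- Let $\mathcal X,\mathcal Y$ be finite alphabets, $W(y|x)$ a discrete memoryless channel from $\mathcal X$ to $\mathcal Y$, and $\Phi$ a probability distribution on $\mathcal X$. Write $\Phi W(y)=\sum_x\Phi(x)W(y|x)$ and $$I(\Phi,W)=\sum_{x,y}\Phi(x)W(y|x)\log\frac{W(y|x)}{\Phi W(y)},$$ $$V(\Phi,W)=\sum_x\Phi(x)\Bigl\{\sum_y W(y|x)\Bigl[\log\tfrac{W(y|x)}{\Phi W(y)}\Bigr]^2-\Bigl[\sum_y W(y|x)\log\tfrac{W(y|x)}{\Phi W(y)}\Bigr]^2\Bigr\},$$ with the convention $0\log 0=0$, and assume $V(\Phi,W)>0$. Let $Q$ be the tail function of the standard normal distribution and fix $\varepsilon\in(0,1)$. For $n\ge 1$ let $\Phi_n$ be an $n$-type (a distribution on $\mathcal X$ with $n\Phi_n(x)\in\mathbb Z$ for all $x$) such that $\|\Phi-\Phi_n\|_\infty\le 1/n$, let $\mathbf x\in\mathcal X^n$ be a sequence with empirical distribution $\Phi_n$, and let $\mathbf Y$ be the output for the input $\mathbf x$, i.e. $\mathbf Y\sim\prod_{i=1}^n W(\cdot|x_i)$.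 Let $P_{\mathbf Y|\mathbf x}(b|a)$ be the fraction, among the positions $i$ with $x_i=a$, of those with $Y_i=b$ (for letters $a$ that do not occur in $\mathbf x$ its value is irrelevant). For $p\in(0,1)$ let the rate redundancy $\Delta R_n(p)$ be the infimum of the real numbers $r$ such that $$\Pr\bigl\{I(\Phi_n,P_{\mathbf Y|\mathbf x})\le I(\Phi,W)-r\bigr\}\le p .$$ Then, as $n\to\infty$, $$\Delta R_n(\varepsilon)=\sqrt{\frac{V(\Phi,W)}{n}}\,Q^{-1}(\varepsilon)+O\Bigl(\frac{\log n}{n}\Bigr).$$ More generally, if $(\delta_n)$ is a real sequence with $\delta_n=O(\log n/\sqrt n)$, then $$\Delta R_n(\varepsilon+\delta_n)=\sqrt{\frac{V(\Phi,W)}{n}}\,Q^{-1}(\varepsilon)+O\Bigl(\frac{\log n}{n}\Bigr)$$ (here $\varepsilon+\delta_n\in(0,1)$ for all large $n$). In both cases the same expansion holds for every real $r=r_n$ that attains the level exactly, i.e. for which the above probability is equal to $\varepsilon$ (respectively $\varepsilon+\delta_n$). The implied constants depend only on $\Phi$, $W$, $\varepsilon$ (and on the sequence $(\delta_n)$), not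 on the choice of $\Phi_n$ and $\mathbf x$. -/

import Mathlib

noncomputable section

namespace DMC

open Finset

variable {X Y : Type*} [Fintype X] [Fintype Y] [DecidableEq X] [DecidableEq Y]

/-- `W` is a discrete memoryless channel: `W x y` is the probability of the output letter `y`
when the input letter is `x`. -/
def IsChannel (W : X → Y → ℝ) : Prop := ∀ x, W x ∈ stdSimplex ℝ Y

/-- The output distribution `ΦW` induced by the input distribution `Φ`. -/
def outDist (Φ : X → ℝ) (W : X → Y → ℝ) (y : Y) : ℝ := ∑ x, Φ x * W x y

/-- The information density `i(x, y) = log (W(y|x) / ΦW(y))`.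
It is only ever used with weight `Φ(x) W(y|x)`, and if this weight is positive, then so are both
arguments of the quotient. -/
def infoDensity (Φ : X → ℝ) (W : X → Y → ℝ) (x : X) (y : Y) : ℝ :=
  Real.log (W x y / outDist Φ W y)

/-- The mutual information `I(Φ, W)` in nats (with `0 log 0 = 0`). -/
def mutualInfo (Φ : X → ℝ) (W : X → Y → ℝ) : ℝ :=
  ∑ x, ∑ y, Φ x * W x y * infoDensity Φ W x y

/-- The conditional information variance
`V(Φ, W) = ∑ x, Φ(x) (∑ y, W(y|x) i(x, y) ^ 2 - D(W_x ‖ ΦW) ^ 2) = E[Var(i(X, Y) | X)]`. -/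
def condInfoVar (Φ : X → ℝ) (W : X → Y → ℝ) : ℝ :=
  ∑ x, Φ x * (∑ y, W x y * infoDensity Φ W x y ^ 2 - (∑ y, W x y * infoDensity Φ W x y) ^ 2)

/-- The probability distributions on `X` whose masses are integer multiples of `1 / n`. -/
def nTypes (X : Type*) [Fintype X] (n : ℕ) : Set (X → ℝ) :=
  {P | P ∈ stdSimplex ℝ X ∧ ∀ a, ∃ k : ℕ, (n : ℝ) * P a = k}

/-- The number `N(a|x)` of occurrences of the letter `a` in the sequence `x`. -/
def count {n : ℕ} (x : Fin n → X) (a : X) : ℕ := #{i | x i = a}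

/-- The number `N(a,b|x,y)` of occurrences of the pair `(a, b)` in the pair of sequences. -/
def jointCount {n : ℕ} (x : Fin n → X) (y : Fin n → Y) (a : X) (b : Y) : ℕ :=
  #{i | x i = a ∧ y i = b}

/-- The set of the sequences of length `n` whose empirical distribution is `P`. -/
def typeClass (n : ℕ) (P : X → ℝ) : Set (Fin n → X) :=
  {x | ∀ a, P a = (count x a : ℝ) / n}

/-- The conditional type `P_{y|x}(b|a) = N(a,b|x,y) / N(a|x)`. For a letter `a` that does not occur
in `x` a conditional type is unconstrained; its value there (here `0`) carries weight
`P_x(a) = 0` in the empirical mutual information `I(P_x, P_{y|x})`. -/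
def condType {n : ℕ} (x : Fin n → X) (y : Fin n → Y) (a : X) (b : Y) : ℝ :=
  (jointCount x y a b : ℝ) / count x a

/-- The probability of the event `E` when the random output sequence `Y` has the law
`W^n(·|x) = ∏ i, W(·|x_i)`. -/
def outputProb {n : ℕ} (W : X → Y → ℝ) (x : Fin n → X) (E : Set (Fin n → Y)) : ℝ :=
  ∑ y, E.indicator (fun y => ∏ i, W (x i) (y i)) y

/-- The probability that the empirical mutual information `I(Φn, P_{Y|x})` is at most
`I(Φ, W) - r`, where `Y` is the output of the channel for the input sequence `x`. -/
def fallProb {n : ℕ} (W : X → Y → ℝ) (Φ Φn : X → ℝ) (x : Fin n → X) (r : ℝ) : ℝ :=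
  outputProb W x {y | mutualInfo Φn (condType x y) ≤ mutualInfo Φ W - r}

/-- The rate redundancy at level `p`: the infimum of the values `r` for which the probability
`fallProb W Φ Φn x r`, a nonincreasing step function of `r`, has come down to the level `p`.
If some `r` makes this probability equal to `p`, then this is also the infimum of all such `r`. -/
def rateRedundancy {n : ℕ} (W : X → Y → ℝ) (Φ Φn : X → ℝ) (x : Fin n → X) (p : ℝ) : ℝ :=
  sInf {r | fallProb W Φ Φn x r ≤ p}

/-- The tail function `Q` of the standard normal distribution. -/
def gaussianQ (z : ℝ) : ℝ := (ProbabilityTheory.gaussianReal 0 1).real (Set.Ioi z)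

/-- The inverse of `Q`, a bijection from the real line to the open interval `(0, 1)`. -/
def gaussianQInv : ℝ → ℝ := Function.invFun gaussianQ

end DMC

end

noncomputable section

namespace DMC

open Finset

/-! ### The standard normal distribution -/

/-! Write `Φn` for the type of `x`. Conditionally on the input, the empirical mutual information is,
up to `O(log n / n)`, an average of independent information densities. The central limit theorem
with its Berry–Esseen rate then gives the law of the fall, and inverting `Q` gives the redundancy.

Linearization. By a Chernoff bound, all joint counts are within `2√(n log n)` of their conditional
means outside an event of probability `O(1/n)`. There `I(Φn, P)` minus its linear part is a
divergence of `P` from `W`, minus a divergence of output laws, both quadratic in a deviation of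
order `√(log n / n)`, plus corrections from letters with `Φ a = 0`. Each such letter occurs at most
once in `x`, and the densities there are at most `log n` in absolute value, since nonzero joint
types are at least `1/n`. Hence `n I(Φn, P)` is a sum of independent terms up to `O(log n)`
(`abs_mutualInfo_sub_le`, `abs_mutualInfo_condType_sub_le`).

Normal approximation. The sum has mean `n I(Φ, W) + O(1)` and variance `n V + O(1)`. Stein's method,
with leave-one-out sums and a concentration inequality, gives an error `O(1/√n)`
(`berry_esseen_bounded`). So the fall probability lies between values of `Q` at `(n r ± O(log n)) /
σ`, up to `O(1/√n)` (`fallProb_bounds`).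

Inversion. `Q` has slope bounded away from zero near `Q⁻¹(ε)`, so a level error `O(log n / √n)`
moves the argument by the same order. Multiplying by `σ / n`, of order `1/√n`, gives `O(log n / n)`;
this is why perturbations `δ n` of that size are harmless (`fallProb_level`). -/

/-- The density of the standard normal distribution. -/
def stdNormalPDF (x : ℝ) : ℝ := ProbabilityTheory.gaussianPDFReal 0 1 x

lemma stdNormalPDF_eq (x : ℝ) : stdNormalPDF x = (√(2 * Real.pi))⁻¹ * Real.exp (-x ^ 2 / 2) := by
  simp [stdNormalPDF, ProbabilityTheory.gaussianPDFReal_def]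

lemma stdNormalPDF_pos (x : ℝ) : 0 < stdNormalPDF x :=
  ProbabilityTheory.gaussianPDFReal_pos _ _ _ one_ne_zero

lemma stdNormalPDF_neg (x : ℝ) : stdNormalPDF (-x) = stdNormalPDF x := by
  simp [stdNormalPDF_eq]

lemma hasDerivAt_stdNormalPDF (x : ℝ) : HasDerivAt stdNormalPDF (-x * stdNormalPDF x) x := by
  have h : HasDerivAt (fun x : ℝ => (√(2 * Real.pi))⁻¹ * Real.exp (-x ^ 2 / 2))
      ((√(2 * Real.pi))⁻¹ * (Real.exp (-x ^ 2 / 2) * (-(2 * x) / 2))) x := by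
    refine HasDerivAt.const_mul _ (HasDerivAt.exp ?_)
    have := ((hasDerivAt_pow 2 x).neg).div_const 2
    simpa using this
  have e : stdNormalPDF = fun x : ℝ => (√(2 * Real.pi))⁻¹ * Real.exp (-x ^ 2 / 2) :=
    funext stdNormalPDF_eq
  rw [stdNormalPDF_eq, e]
  convert h using 1
  ring

lemma continuous_stdNormalPDF : Continuous stdNormalPDF :=
  continuous_iff_continuousAt.2 fun x => (hasDerivAt_stdNormalPDF x).continuousAt

lemma stdNormalPDF_anti {x y : ℝ} (h : |x| ≤ |y|) : stdNormalPDF y ≤ stdNormalPDF x := by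
  rw [stdNormalPDF_eq, stdNormalPDF_eq]
  have := sq_le_sq.2 h
  gcongr

lemma stdNormalPDF_le_one (x : ℝ) : stdNormalPDF x ≤ 1 := by
  rw [stdNormalPDF_eq]
  have h1 : 1 ≤ √(2 * Real.pi) := by
    rw [Real.one_le_sqrt]; linarith [Real.pi_gt_three]
  have h2 : Real.exp (-x ^ 2 / 2) ≤ 1 := Real.exp_le_one_iff.2 (by nlinarith [sq_nonneg x])
  exact mul_le_one₀ (inv_le_one_of_one_le₀ h1) (Real.exp_nonneg _) h2

lemma integrable_stdNormalPDF : MeasureTheory.Integrable stdNormalPDF :=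
  ProbabilityTheory.integrable_gaussianPDFReal 0 1

lemma gaussianQ_eq_integral (z : ℝ) : gaussianQ z = ∫ x in Set.Ioi z, stdNormalPDF x := by
  rw [gaussianQ, MeasureTheory.measureReal_def,
    ProbabilityTheory.gaussianReal_apply_eq_integral _ one_ne_zero,
    ENNReal.toReal_ofReal (MeasureTheory.integral_nonneg fun x =>
      ProbabilityTheory.gaussianPDFReal_nonneg _ _ _)]
  rfl

lemma gaussianQ_nonneg (z : ℝ) : 0 ≤ gaussianQ z := MeasureTheory.measureReal_nonneg

lemma gaussianQ_le_one (z : ℝ) : gaussianQ z ≤ 1 := MeasureTheory.measureReal_le_one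

lemma gaussianQ_antitone : Antitone gaussianQ := fun _ _ h =>
  MeasureTheory.measureReal_mono (Set.Ioi_subset_Ioi h)

lemma gaussianQ_neg (z : ℝ) : gaussianQ (-z) = 1 - gaussianQ z := by
  have h1 : gaussianQ (-z) = ∫ x in Set.Iic z, stdNormalPDF x := by
    rw [gaussianQ_eq_integral, ← integral_comp_neg_Iic]
    simp [stdNormalPDF_neg]
  have h2 : ∫ x, stdNormalPDF x = 1 :=
    ProbabilityTheory.integral_gaussianPDFReal_eq_one 0 one_ne_zero
  rw [h1, gaussianQ_eq_integral, ← h2,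
    ← intervalIntegral.integral_Iic_add_Ioi (b := z) integrable_stdNormalPDF.integrableOn
      integrable_stdNormalPDF.integrableOn]
  ring

lemma hasDerivAt_gaussianQ (z : ℝ) : HasDerivAt gaussianQ (-stdNormalPDF z) z := by
  have h : gaussianQ = fun z => gaussianQ 0 - ∫ x in (0 : ℝ)..z, stdNormalPDF x := by
    funext z
    rw [gaussianQ_eq_integral, gaussianQ_eq_integral,
      ← intervalIntegral.integral_interval_add_Ioi (a := 0) (b := z)
        integrable_stdNormalPDF.integrableOn integrable_stdNormalPDF.integrableOn]
    ring
  rw [h]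
  exact (continuous_stdNormalPDF.integral_hasStrictDerivAt 0 z).hasDerivAt.const_sub _

lemma continuous_gaussianQ : Continuous gaussianQ :=
  continuous_iff_continuousAt.2 fun x => (hasDerivAt_gaussianQ x).continuousAt

lemma tendsto_gaussianQ_atTop : Filter.Tendsto gaussianQ Filter.atTop (nhds 0) := by
  have h := ProbabilityTheory.tendsto_cdf_atTop (ProbabilityTheory.gaussianReal 0 1)
  have e : gaussianQ = fun z => 1 - ProbabilityTheory.cdf (ProbabilityTheory.gaussianReal 0 1) z := by
    funext z
    rw [ProbabilityTheory.cdf_eq_real, gaussianQ, ← Set.compl_Iic,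
      MeasureTheory.probReal_compl_eq_one_sub measurableSet_Iic]
  rw [e]
  simpa using h.const_sub 1

lemma tendsto_gaussianQ_atBot : Filter.Tendsto gaussianQ Filter.atBot (nhds 1) := by
  have h := (tendsto_gaussianQ_atTop.comp Filter.tendsto_neg_atBot_atTop).const_sub 1
  simp only [sub_zero] at h
  refine h.congr fun z => ?_
  simp [gaussianQ_neg]

lemma gaussianQ_gaussianQInv {ε : ℝ} (hε : ε ∈ Set.Ioo (0 : ℝ) 1) :
    gaussianQ (gaussianQInv ε) = ε := by
  refine Function.invFun_eq ?_
  obtain ⟨a, ha⟩ := (tendsto_gaussianQ_atTop.eventually (gt_mem_nhds hε.1)).exists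
  obtain ⟨b, hb⟩ := (tendsto_gaussianQ_atBot.eventually (lt_mem_nhds hε.2)).exists
  exact mem_range_of_exists_le_of_exists_ge continuous_gaussianQ ⟨a, ha.le⟩ ⟨b, hb.le⟩

/-- Since `-φ` is a primitive of `x φ(x)`, integrating `w φ(x) ≤ x φ(x)` over `x > w` gives the
density at `w`. -/
lemma mul_gaussianQ_le (w : ℝ) : w * gaussianQ w ≤ stdNormalPDF w := by
  have hd : ∀ x ∈ Set.Ici w, HasDerivAt (fun x => -stdNormalPDF x) (x * stdNormalPDF x) x :=
    fun x _ => (hasDerivAt_stdNormalPDF x).fun_neg.congr_deriv (by ring)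
  have hi : MeasureTheory.Integrable fun x => x * stdNormalPDF x := by
    have := (integrable_mul_exp_neg_mul_sq (b := 1 / 2) (by norm_num)).const_mul
      (√(2 * Real.pi))⁻¹
    refine this.congr (Filter.Eventually.of_forall fun x => ?_)
    simp only [stdNormalPDF_eq]
    ring_nf
  have hl : Filter.Tendsto (fun x => -stdNormalPDF x) Filter.atTop (nhds (-0)) := by
    refine Filter.Tendsto.neg ?_
    have e : stdNormalPDF = fun x : ℝ => (√(2 * Real.pi))⁻¹ * Real.exp (-x ^ 2 / 2) :=
      funext stdNormalPDF_eq
    rw [e, ← mul_zero (√(2 * Real.pi))⁻¹]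
    refine Filter.Tendsto.const_mul _ (Real.tendsto_exp_atBot.comp ?_)
    have : Filter.Tendsto (fun x : ℝ => x ^ 2 / 2) Filter.atTop Filter.atTop :=
      (Filter.tendsto_pow_atTop two_ne_zero).atTop_div_const (by norm_num)
    refine (Filter.tendsto_neg_atTop_atBot.comp this).congr fun x => ?_
    simp [neg_div]
  have h := MeasureTheory.integral_Ioi_of_hasDerivAt_of_tendsto' hd hi.integrableOn hl
  have h2 : w * gaussianQ w ≤ ∫ x in Set.Ioi w, x * stdNormalPDF x := by
    rw [gaussianQ_eq_integral, ← MeasureTheory.integral_const_mul]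
    refine MeasureTheory.setIntegral_mono_on (integrable_stdNormalPDF.integrableOn.const_mul _)
      hi.integrableOn measurableSet_Ioi fun x hx => ?_
    exact mul_le_mul_of_nonneg_right (le_of_lt hx) (stdNormalPDF_pos x).le
  rw [h] at h2
  linarith

/-- On a bounded interval the slope of `Q` is bounded away from zero. -/
lemma gaussianQ_sub_le (z : ℝ) : ∃ m > 0, ∀ a b, z - 1 ≤ a → a ≤ b → b ≤ z + 1 →
    m * (b - a) ≤ gaussianQ a - gaussianQ b := by
  -- The density decreases in `|x|`, and `|x| ≤ |z| + 1` throughout the window.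
  refine ⟨stdNormalPDF (|z| + 1), stdNormalPDF_pos _, fun a b ha hab hb => ?_⟩
  have := (convex_Icc a b).image_sub_le_mul_sub_of_deriv_le (f := gaussianQ)
    (C := -stdNormalPDF (|z| + 1)) continuous_gaussianQ.continuousOn
    (fun x _ => (hasDerivAt_gaussianQ x).differentiableAt.differentiableWithinAt) (fun x hx => ?_)
    a ⟨le_rfl, hab⟩ b ⟨hab, le_rfl⟩ hab
  · linarith
  · rw [interior_Icc] at hx
    rw [(hasDerivAt_gaussianQ x).deriv]
    refine neg_le_neg (stdNormalPDF_anti ?_)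
    rw [abs_of_nonneg (by positivity : (0 : ℝ) ≤ |z| + 1), abs_le]
    constructor <;> cases abs_cases z <;> linarith [hx.1, hx.2]

/-! ### Mills' ratio and the solution of Stein's equation -/

/-- Mills' ratio of the standard normal distribution. -/
def millsRatio (w : ℝ) : ℝ := gaussianQ w / stdNormalPDF w

/-- A bound for Mills' ratio on the nonnegative half line. -/
def millsBound : ℝ := (stdNormalPDF 1)⁻¹

lemma one_le_millsBound : 1 ≤ millsBound :=
  (one_le_inv₀ (stdNormalPDF_pos 1)).2 (stdNormalPDF_le_one 1)

lemma millsRatio_nonneg (w : ℝ) : 0 ≤ millsRatio w :=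
  div_nonneg (gaussianQ_nonneg w) (stdNormalPDF_pos w).le

lemma mul_millsRatio_le (w : ℝ) : w * millsRatio w ≤ 1 := by
  rw [millsRatio, ← mul_div_assoc, div_le_one (stdNormalPDF_pos w)]
  exact mul_gaussianQ_le w

lemma millsRatio_le {w : ℝ} (hw : 0 ≤ w) : millsRatio w ≤ millsBound := by
  rcases le_total w 1 with h | h
  · rw [millsRatio, millsBound, ← one_div]
    have : stdNormalPDF 1 ≤ stdNormalPDF w :=
      stdNormalPDF_anti (by rwa [abs_of_nonneg hw, abs_one])
    exact div_le_div₀ zero_le_one (gaussianQ_le_one w) (stdNormalPDF_pos 1) this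
  · have h1 := mul_millsRatio_le w
    have h2 := millsRatio_nonneg w
    have h3 := one_le_millsBound
    nlinarith

lemma hasDerivAt_millsRatio (w : ℝ) : HasDerivAt millsRatio (w * millsRatio w - 1) w := by
  have h0 := (stdNormalPDF_pos w).ne'
  refine ((hasDerivAt_gaussianQ w).div (hasDerivAt_stdNormalPDF w) h0).congr_deriv ?_
  rw [millsRatio]
  field_simp
  ring

/-- The bounded solution of Stein's equation `f' w - w * f w = 1_{w ≤ z} - Q (-z)`. -/
def steinSol (z w : ℝ) : ℝ :=
  if w ≤ z then millsRatio (-w) * gaussianQ z else millsRatio w * gaussianQ (-z)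

/-- The derivative of `steinSol z` away from `z`. -/
def steinDeriv (z w : ℝ) : ℝ :=
  w * steinSol z w + (if w ≤ z then 1 else 0) - gaussianQ (-z)

lemma steinSol_of_ge {z w : ℝ} (h : z ≤ w) : steinSol z w = millsRatio w * gaussianQ (-z) := by
  rcases h.eq_or_lt with rfl | h
  · simp only [steinSol, le_refl, if_true, millsRatio, stdNormalPDF_neg]
    ring
  · simp [steinSol, not_le.2 h]

/-- This reflection reduces bounds for negative `w` to Mills' ratio on the nonnegative half line. -/
lemma steinSol_neg (z w : ℝ) : steinSol (-z) (-w) = steinSol z w := by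
  rcases le_total w z with h | h
  · rw [steinSol_of_ge (neg_le_neg h)]
    simp [steinSol, h]
  · rw [steinSol_of_ge h]
    simp [steinSol, h]

lemma steinSol_nonneg (z w : ℝ) : 0 ≤ steinSol z w := by
  unfold steinSol
  split_ifs
  · exact mul_nonneg (millsRatio_nonneg _) (gaussianQ_nonneg _)
  · exact mul_nonneg (millsRatio_nonneg _) (gaussianQ_nonneg _)

/-- For `w ≤ z` the solution is `Q(-w) Q(z) / φ(w)`, and `Q(z) ≤ Q(w)`; otherwise the extra factor
is at most one. -/
lemma steinSol_le_millsRatio (z w : ℝ) : steinSol z w ≤ millsRatio w := by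
  unfold steinSol
  split_ifs with h
  · have h1 : millsRatio (-w) * gaussianQ z = gaussianQ (-w) * gaussianQ z / stdNormalPDF w := by
      rw [millsRatio, stdNormalPDF_neg]; ring
    rw [h1, millsRatio]
    refine div_le_div_of_nonneg_right ?_ (stdNormalPDF_pos w).le
    calc gaussianQ (-w) * gaussianQ z ≤ 1 * gaussianQ w :=
          mul_le_mul (gaussianQ_le_one _) (gaussianQ_antitone h) (gaussianQ_nonneg _) zero_le_one
      _ = gaussianQ w := one_mul _
  · exact mul_le_of_le_one_right (millsRatio_nonneg _) (gaussianQ_le_one _)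

lemma steinSol_le (z w : ℝ) : steinSol z w ≤ millsBound := by
  rcases le_total 0 w with h | h
  · exact (steinSol_le_millsRatio z w).trans (millsRatio_le h)
  · rw [← steinSol_neg]
    exact (steinSol_le_millsRatio (-z) (-w)).trans (millsRatio_le (neg_nonneg.2 h))

lemma abs_mul_steinSol_le (z w : ℝ) : |w * steinSol z w| ≤ 1 := by
  rw [abs_mul, abs_of_nonneg (steinSol_nonneg z w)]
  rcases le_total 0 w with h | h
  · rw [abs_of_nonneg h]
    exact (mul_le_mul_of_nonneg_left (steinSol_le_millsRatio z w) h).trans (mul_millsRatio_le w)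
  · rw [← steinSol_neg, abs_of_nonpos h]
    exact (mul_le_mul_of_nonneg_left (steinSol_le_millsRatio (-z) (-w))
      (neg_nonneg.2 h)).trans (mul_millsRatio_le (-w))

lemma abs_steinDeriv_le (z w : ℝ) : |steinDeriv z w| ≤ 2 := by
  have h1 := abs_le.1 (abs_mul_steinSol_le z w)
  have h2 := gaussianQ_nonneg (-z)
  have h3 := gaussianQ_le_one (-z)
  rw [steinDeriv, abs_le]
  split_ifs <;> constructor <;> linarith [h1.1, h1.2]

lemma hasDerivAt_steinSol {z w : ℝ} (h : w ≠ z) :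
    HasDerivAt (steinSol z) (steinDeriv z w) w := by
  rcases h.lt_or_gt with h | h
  · have h1 : HasDerivAt (fun w => millsRatio (-w) * gaussianQ z)
        (-(-w * millsRatio (-w) - 1) * gaussianQ z) w := by
      have := (hasDerivAt_millsRatio (-w)).comp w (hasDerivAt_neg w)
      exact (this.mul_const (gaussianQ z)).congr_deriv (by ring)
    have h2 : HasDerivAt (steinSol z) (-(-w * millsRatio (-w) - 1) * gaussianQ z) w := by
      refine h1.congr_of_eventuallyEq ?_
      filter_upwards [gt_mem_nhds h] with t ht
      simp [steinSol, le_of_lt ht]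
    convert h2 using 1
    rw [steinDeriv, steinSol, if_pos h.le, if_pos h.le, gaussianQ_neg z]
    ring
  · have h1 := (hasDerivAt_millsRatio w).mul_const (gaussianQ (-z))
    have h2 : HasDerivAt (steinSol z) ((w * millsRatio w - 1) * gaussianQ (-z)) w := by
      refine h1.congr_of_eventuallyEq ?_
      filter_upwards [lt_mem_nhds h] with t ht
      simp [steinSol, not_le.2 ht]
    convert h2 using 1
    rw [steinDeriv, steinSol, if_neg h.not_ge, if_neg h.not_ge]
    ring

lemma continuous_millsRatio : Continuous millsRatio :=
  continuous_iff_continuousAt.2 fun x => (hasDerivAt_millsRatio x).continuousAt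

lemma continuous_steinSol (z : ℝ) : Continuous (steinSol z) := by
  refine Continuous.if_le ((continuous_millsRatio.comp continuous_neg).mul continuous_const) ?_
    continuous_id continuous_const fun w hw => ?_
  · exact continuous_millsRatio.mul continuous_const
  · have := steinSol_of_ge (show z ≤ w from hw.ge)
    rwa [steinSol, if_pos hw.le] at this

/-- The derivative is bounded by 2 on either side of the kink at `z`; intervals crossing `z` are
split there. -/
lemma abs_steinSol_sub_le (z w w' : ℝ) : |steinSol z w' - steinSol z w| ≤ 2 * |w' - w| := by
  have key : ∀ s : Set ℝ, Convex ℝ s → z ∉ interior s → ∀ a ∈ s, ∀ b ∈ s, a ≤ b →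
      |steinSol z b - steinSol z a| ≤ 2 * |b - a| := by
    intro s hs hz a ha b hb hab
    have hd : ∀ x ∈ interior s, HasDerivAt (steinSol z) (steinDeriv z x) x := fun x hx =>
      hasDerivAt_steinSol fun h => hz (h ▸ hx)
    have h1 := hs.image_sub_le_mul_sub_of_deriv_le (f := steinSol z) (C := 2)
      (continuous_steinSol z).continuousOn
      (fun x hx => (hd x hx).differentiableAt.differentiableWithinAt)
      (fun x hx => by rw [(hd x hx).deriv]; exact (abs_le.1 (abs_steinDeriv_le z x)).2) a ha b hb hab
    have h2 := hs.mul_sub_le_image_sub_of_le_deriv (f := steinSol z) (C := -2)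
      (continuous_steinSol z).continuousOn
      (fun x hx => (hd x hx).differentiableAt.differentiableWithinAt)
      (fun x hx => by rw [(hd x hx).deriv]; exact (abs_le.1 (abs_steinDeriv_le z x)).1) a ha b hb hab
    rw [abs_of_nonneg (sub_nonneg.2 hab), abs_le]
    constructor <;> linarith
  have main : ∀ a b, a ≤ b → |steinSol z b - steinSol z a| ≤ 2 * |b - a| := by
    intro a b hab
    rcases le_total b z with h | h
    · exact key (Set.Iic z) (convex_Iic z) (by simp) a (hab.trans h) b h hab
    rcases le_total a z with h' | h'
    · have h1 := key (Set.Iic z) (convex_Iic z) (by simp) a h' z Set.self_mem_Iic h'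
      have h2 := key (Set.Ici z) (convex_Ici z) (by simp) z Set.self_mem_Ici b h h
      rw [abs_of_nonneg (sub_nonneg.2 h')] at h1
      rw [abs_of_nonneg (sub_nonneg.2 h)] at h2
      rw [abs_of_nonneg (sub_nonneg.2 hab)]
      have := abs_sub_le (steinSol z b) (steinSol z z) (steinSol z a)
      linarith
    · exact key (Set.Ici z) (convex_Ici z) (by simp) a h' b h hab
  rcases le_total w w' with h | h
  · exact main w w' h
  · rw [abs_sub_comm, abs_sub_comm w']
    exact main w' w h

/-- By its definition from Stein's equation, the derivative is a locally Lipschitz part `w f(w)`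
plus an indicator, which can jump only if `w` is within `δ` of `z`. -/
lemma abs_steinDeriv_sub_le {z w s δ : ℝ} (hs : |s| ≤ δ) :
    |steinDeriv z (w + s) - steinDeriv z w| ≤
      δ * (2 * |w| + millsBound) + if |w - z| ≤ δ then 1 else 0 := by
  have h1 : |(w + s) * steinSol z (w + s) - w * steinSol z w| ≤ δ * (2 * |w| + millsBound) := by
    have e : (w + s) * steinSol z (w + s) - w * steinSol z w =
        w * (steinSol z (w + s) - steinSol z w) + s * steinSol z (w + s) := by ring
    rw [e]
    refine (abs_add_le _ _).trans ?_
    rw [abs_mul, abs_mul, abs_of_nonneg (steinSol_nonneg z (w + s))]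
    have h2 := abs_steinSol_sub_le z w (w + s)
    rw [add_sub_cancel_left] at h2
    have h3 := steinSol_le z (w + s)
    have h4 : |w| * |steinSol z (w + s) - steinSol z w| ≤ |w| * (2 * δ) := by
      gcongr
      linarith
    have h5 : |s| * steinSol z (w + s) ≤ δ * millsBound :=
      mul_le_mul hs h3 (steinSol_nonneg _ _) ((abs_nonneg s).trans hs)
    linarith
  have h2 : |(if w + s ≤ z then (1 : ℝ) else 0) - (if w ≤ z then 1 else 0)| ≤
      if |w - z| ≤ δ then 1 else 0 := by
    have hs' := abs_le.1 hs
    by_cases hc : |w - z| ≤ δ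
    · rw [if_pos hc]
      split_ifs <;> norm_num
    · rw [if_neg hc]
      have : w + s ≤ z ↔ w ≤ z := by
        rw [abs_le, not_and_or, not_le, not_le] at hc
        constructor <;> intro h <;> rcases hc with hc | hc <;> linarith [hs'.1, hs'.2]
      simp [this]
  have e : steinDeriv z (w + s) - steinDeriv z w =
      ((w + s) * steinSol z (w + s) - w * steinSol z w) +
        ((if w + s ≤ z then (1 : ℝ) else 0) - (if w ≤ z then 1 else 0)) := by
    simp only [steinDeriv]; ring
  rw [e]
  exact (abs_add_le _ _).trans (add_le_add h1 h2)

lemma abs_steinSol_taylor_le {z w s δ : ℝ} (hs : |s| ≤ δ) :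
    |steinSol z (w + s) - steinSol z w - s * steinDeriv z w| ≤
      |s| * (δ * (2 * |w| + millsBound) + 4 * if |w - z| ≤ δ then 1 else 0) := by
  have hB := one_le_millsBound
  have hδ := (abs_nonneg s).trans hs
  by_cases hc : |w - z| ≤ δ
  -- The segment may meet the kink, so Taylor is replaced by the crude bounds `2|s|` for the
  -- increment and `2|s|` for the linear term.
  · rw [if_pos hc]
    have h1 := abs_steinSol_sub_le z w (w + s)
    rw [add_sub_cancel_left] at h1
    have h2 : |s * steinDeriv z w| ≤ |s| * 2 := by
      rw [abs_mul]
      exact mul_le_mul_of_nonneg_left (abs_steinDeriv_le z w) (abs_nonneg s)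
    have h3 := abs_sub (steinSol z (w + s) - steinSol z w) (s * steinDeriv z w)
    have h4 : 0 ≤ |s| * (δ * (2 * |w| + millsBound)) := by positivity
    linarith
  · rw [if_neg hc]
    have hseg : ∀ t ∈ segment ℝ w (w + s), |t - w| ≤ |s| := by
      intro t ht
      rw [segment_eq_image'] at ht
      obtain ⟨θ, hθ, rfl⟩ := ht
      simp only [add_sub_cancel_left, smul_eq_mul, abs_mul, abs_of_nonneg hθ.1]
      exact mul_le_of_le_one_left (abs_nonneg s) hθ.2
    -- Away from the kink, the mean value inequality is applied to `f(t) - t f'(w)`, whose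
    -- derivative is the difference bounded above.
    have h := (convex_segment w (w + s)).norm_image_sub_le_of_norm_hasDerivWithin_le
      (f := fun t => steinSol z t - t * steinDeriv z w)
      (f' := fun t => steinDeriv z t - 1 * steinDeriv z w)
      (C := δ * (2 * |w| + millsBound)) (x := w) (y := w + s) ?_ ?_
      (left_mem_segment _ _ _) (right_mem_segment _ _ _)
    · rw [Real.norm_eq_abs, Real.norm_eq_abs, add_sub_cancel_left] at h
      calc _ = |steinSol z (w + s) - (w + s) * steinDeriv z w -
            (steinSol z w - w * steinDeriv z w)| := by congr 1; ring
        _ ≤ _ := h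
        _ = _ := by ring
    · intro t ht
      refine HasDerivAt.hasDerivWithinAt (HasDerivAt.sub (hasDerivAt_steinSol ?_)
        ((hasDerivAt_id t).mul_const _))
      rintro rfl
      exact hc (by rw [abs_sub_comm]; exact (hseg _ ht).trans hs)
    · intro t ht
      have := abs_steinDeriv_sub_le (z := z) (w := w) ((hseg t ht).trans hs)
      rw [if_neg hc, add_zero, add_sub_cancel] at this
      simpa using this

/-! ### Expectations under finite product measures -/

section Product

variable {ι B : Type*} [Fintype ι] [Fintype B] [DecidableEq ι]

/-- The expectation of `F` under the product of the mass functions `p i`. -/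
def prodExp (p : ι → B → ℝ) (F : (ι → B) → ℝ) : ℝ := ∑ y, (∏ i, p i (y i)) * F y

variable {p : ι → B → ℝ}

lemma prodExp_prod (f : ι → B → ℝ) :
    prodExp p (fun y => ∏ i, f i (y i)) = ∏ i, ∑ b, p i b * f i b := by
  rw [Finset.prod_univ_sum, Fintype.piFinset_univ]
  simp only [prodExp, prod_mul_distrib]

lemma prodExp_const (hp : ∀ i, p i ∈ stdSimplex ℝ B) (c : ℝ) : prodExp p (fun _ => c) = c := by
  have h := prodExp_prod (p := p) (fun _ _ => 1)
  simp only [prod_const_one, mul_one, (hp _).2] at h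
  calc prodExp p (fun _ => c) = prodExp p (fun _ => 1) * c := by
        simp [prodExp, sum_mul]
    _ = c := by rw [h, one_mul]

lemma prodExp_add (F G : (ι → B) → ℝ) :
    prodExp p (fun y => F y + G y) = prodExp p F + prodExp p G := by
  simp [prodExp, mul_add, sum_add_distrib]

lemma prodExp_sub (F G : (ι → B) → ℝ) :
    prodExp p (fun y => F y - G y) = prodExp p F - prodExp p G := by
  simp [prodExp, mul_sub, sum_sub_distrib]

lemma prodExp_const_mul (c : ℝ) (F : (ι → B) → ℝ) :
    prodExp p (fun y => c * F y) = c * prodExp p F := by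
  simp only [prodExp, mul_sum]
  exact sum_congr rfl fun _ _ => by ring

lemma prodExp_sum {κ : Type*} (s : Finset κ) (F : κ → (ι → B) → ℝ) :
    prodExp p (fun y => ∑ k ∈ s, F k y) = ∑ k ∈ s, prodExp p (F k) := by
  simp only [prodExp, mul_sum]
  exact sum_comm

lemma prodExp_mono (hp : ∀ i, p i ∈ stdSimplex ℝ B) {F G : (ι → B) → ℝ} (h : ∀ y, F y ≤ G y) :
    prodExp p F ≤ prodExp p G :=
  sum_le_sum fun y _ => mul_le_mul_of_nonneg_left (h y) (prod_nonneg fun i _ => (hp i).1 _)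

/-- Only outcomes of positive probability need comparing; the linearization is available only for
these. -/
lemma prodExp_mono_of_pos (hp : ∀ i, p i ∈ stdSimplex ℝ B) {F G : (ι → B) → ℝ}
    (h : ∀ y, (∀ i, 0 < p i (y i)) → F y ≤ G y) : prodExp p F ≤ prodExp p G := by
  refine sum_le_sum fun y _ => ?_
  by_cases hy : ∀ i, 0 < p i (y i)
  · exact mul_le_mul_of_nonneg_left (h y hy) (prod_nonneg fun i _ => (hp i).1 _)
  · push Not at hy
    obtain ⟨i, hi⟩ := hy
    rw [prod_eq_zero (mem_univ i) (le_antisymm hi ((hp i).1 _)), zero_mul, zero_mul]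

lemma abs_prodExp_le (hp : ∀ i, p i ∈ stdSimplex ℝ B) {F G : (ι → B) → ℝ}
    (h : ∀ y, |F y| ≤ G y) : |prodExp p F| ≤ prodExp p G := by
  refine abs_le.2 ⟨?_, prodExp_mono hp fun y => (abs_le.1 (h y)).2⟩
  have := prodExp_mono hp fun y => (abs_le.1 (h y)).1
  have e : prodExp p (fun y => -G y) = -prodExp p G := by simp [prodExp]
  rwa [e] at this

/-- A function of the `i`-th coordinate is independent of a function of the other ones. -/
lemma prodExp_mul_of_update (hp : ∀ i, p i ∈ stdSimplex ℝ B) (i : ι) (a : B → ℝ)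
    {G : (ι → B) → ℝ} (hG : ∀ y b, G (Function.update y i b) = G y) :
    prodExp p (fun y => a (y i) * G y) = (∑ b, p i b * a b) * prodExp p G := by
  have key : ∀ a : B → ℝ, prodExp p (fun y => a (y i) * G y) =
      (∑ b, p i b * a b) * ∑ z : {j // j ≠ i} → B, (∏ j : {j // j ≠ i}, p j (z j)) *
        ∑ b, p i b * G ((Equiv.funSplitAt i B).symm (b, z)) := by
    intro a
    have e : ∀ b c z, G ((Equiv.funSplitAt i B).symm (b, z)) =
        G ((Equiv.funSplitAt i B).symm (c, z)) := by
      intro b c z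
      rw [← hG ((Equiv.funSplitAt i B).symm (c, z)) b]
      congr 1
      ext j
      by_cases h : j = i
      · subst h; simp [Equiv.funSplitAt, Equiv.piSplitAt]
      · simp [Equiv.funSplitAt, Equiv.piSplitAt, h]
    have e' : ∀ b z, ∑ c, p i c * G ((Equiv.funSplitAt i B).symm (c, z)) =
        G ((Equiv.funSplitAt i B).symm (b, z)) := by
      intro b z
      rw [sum_congr rfl fun c _ => by rw [e c b z], ← sum_mul, (hp i).2, one_mul]
    rw [prodExp, ← (Equiv.funSplitAt i B).symm.sum_comp, Fintype.sum_prod_type, sum_mul]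
    refine sum_congr rfl fun b _ => ?_
    rw [mul_sum]
    refine sum_congr rfl fun z _ => ?_
    rw [e' b z, Fintype.prod_eq_mul_prod_subtype_ne _ i]
    have h1 : (Equiv.funSplitAt i B).symm (b, z) i = b := by
      simp [Equiv.funSplitAt, Equiv.piSplitAt]
    have h2 : ∀ j : {j // j ≠ i}, (Equiv.funSplitAt i B).symm (b, z) j = z j := by
      intro j
      simp [Equiv.funSplitAt, Equiv.piSplitAt, j.2]
    simp only [h1, h2]
    ring
  -- The constant function identifies the remaining factor in `key` as the expectation of `G`.
  have h1 := key fun _ => 1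
  simp only [one_mul, mul_one, (hp i).2] at h1
  rw [key a, ← h1]

end Product

/-! ### The Berry-Esseen theorem for bounded summands -/

section BerryEsseen

variable {ι B : Type*} [Fintype ι] [Fintype B] [DecidableEq ι] {p : ι → B → ℝ} {ξ : ι → B → ℝ}

omit [Fintype B] in
lemma sum_update_sub (i : ι) (y : ι → B) (b : B) :
    ∑ j, ξ j (Function.update y i b j) - ξ i (Function.update y i b i) =
      ∑ j, ξ j (y j) - ξ i (y i) := by
  rw [← add_sum_erase _ _ (mem_univ i), ← add_sum_erase univ (fun j => ξ j (y j)) (mem_univ i),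
    add_sub_cancel_left, add_sub_cancel_left]
  exact sum_congr rfl fun j hj => by rw [Function.update_of_ne (ne_of_mem_erase hj)]

lemma prodExp_mul_sum_sub (hp : ∀ i, p i ∈ stdSimplex ℝ B) (i : ι) (a : B → ℝ) (F : ℝ → ℝ) :
    prodExp p (fun y => a (y i) * F (∑ j, ξ j (y j) - ξ i (y i))) =
      (∑ b, p i b * a b) * prodExp p (fun y => F (∑ j, ξ j (y j) - ξ i (y i))) :=
  prodExp_mul_of_update hp i a fun y b => by rw [sum_update_sub]

/-- Each `ξ i` is centered and independent of the leave-one-out sum, so subtracting `F` of that sum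
does not change the expectation. -/
lemma prodExp_sum_mul (hp : ∀ i, p i ∈ stdSimplex ℝ B) (h1 : ∀ i, ∑ b, p i b * ξ i b = 0)
    (F : ℝ → ℝ) :
    prodExp p (fun y => (∑ j, ξ j (y j)) * F (∑ j, ξ j (y j))) =
      ∑ i, prodExp p (fun y => ξ i (y i) *
        (F (∑ j, ξ j (y j)) - F (∑ j, ξ j (y j) - ξ i (y i)))) := by
  have h : ∀ i, prodExp p (fun y => ξ i (y i) *
      (F (∑ j, ξ j (y j)) - F (∑ j, ξ j (y j) - ξ i (y i)))) =
      prodExp p (fun y => ξ i (y i) * F (∑ j, ξ j (y j))) := by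
    intro i
    simp only [mul_sub]
    rw [prodExp_sub, prodExp_mul_sum_sub hp i, h1, zero_mul, sub_zero]
  simp only [h, ← prodExp_sum, sum_mul]

/-- The leave-one-out identity with `F = id` gives second moment one, and `|S| ≤ (1 + S²) / 2`. -/
lemma prodExp_abs_sum_le (hp : ∀ i, p i ∈ stdSimplex ℝ B) (h1 : ∀ i, ∑ b, p i b * ξ i b = 0)
    (h2 : ∑ i, ∑ b, p i b * ξ i b ^ 2 = 1) : prodExp p (fun y => |∑ j, ξ j (y j)|) ≤ 1 := by
  have h := prodExp_sum_mul hp h1 id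
  have h3 : ∀ i, prodExp p (fun y => ξ i (y i) * (id (∑ j, ξ j (y j)) -
      id (∑ j, ξ j (y j) - ξ i (y i)))) = ∑ b, p i b * ξ i b ^ 2 := by
    intro i
    have := prodExp_mul_sum_sub (ξ := ξ) hp i (fun b => ξ i b ^ 2) (fun _ => 1)
    rw [prodExp_const hp, mul_one] at this
    rw [← this]
    congr 1
    ext y
    simp only [id]
    ring
  rw [sum_congr rfl fun i _ => h3 i, h2] at h
  calc prodExp p (fun y => |∑ j, ξ j (y j)|) ≤
      prodExp p (fun y => 1 / 2 + 1 / 2 * ((∑ j, ξ j (y j)) * id (∑ j, ξ j (y j)))) := by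
        refine prodExp_mono hp fun y => ?_
        simp only [id]
        nlinarith [sq_nonneg (|∑ j, ξ j (y j)| - 1), abs_mul_abs_self (∑ j, ξ j (y j))]
    _ = 1 := by
        rw [prodExp_add, prodExp_const hp, prodExp_const_mul, h]; norm_num

/-- The concentration inequality: a standardized sum of independent bounded variables
puts little mass on short intervals. -/
lemma prodExp_concentration (hp : ∀ i, p i ∈ stdSimplex ℝ B) (h1 : ∀ i, ∑ b, p i b * ξ i b = 0)
    (h2 : ∑ i, ∑ b, p i b * ξ i b ^ 2 = 1) {δ : ℝ} (hδ : 0 ≤ δ) (h3 : ∀ i b, |ξ i b| ≤ δ)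
    (c : ℝ) {t : ℝ} (ht : 0 ≤ t) :
    prodExp p (fun y => if |∑ j, ξ j (y j) - c| ≤ t then 1 else 0) ≤ t + 2 * δ := by
  -- A clipped ramp of slope one around `c`. The margin `2δ` keeps both `S` and `S - ξ i` in the
  -- linear range when `S - ξ i` is within `t + δ` of `c`. Then `E[S F(S)]` dominates the window
  -- probability and is at most `t + 2δ`.
  set F : ℝ → ℝ := fun w => max (-(t + 2 * δ)) (min (t + 2 * δ) (w - c)) with hF
  have hFabs : ∀ w, |F w| ≤ t + 2 * δ := fun w => by
    rw [abs_le]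
    exact ⟨le_max_left _ _, max_le (by linarith) (min_le_left _ _)⟩
  have hFmono : Monotone F := fun a b hab => by
    simp only [hF]
    gcongr
  have hFin : ∀ w, |w - c| ≤ t + 2 * δ → F w = w - c := fun w hw => by
    rw [abs_le] at hw
    simp only [hF]
    rw [min_eq_right hw.2, max_eq_right hw.1]
  have upper : prodExp p (fun y => (∑ j, ξ j (y j)) * F (∑ j, ξ j (y j))) ≤ t + 2 * δ := by
    calc _ ≤ prodExp p (fun y => (t + 2 * δ) * |∑ j, ξ j (y j)|) := by
          refine prodExp_mono hp fun y => (le_abs_self _).trans ?_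
          rw [abs_mul, mul_comm]
          exact mul_le_mul_of_nonneg_right (hFabs _) (abs_nonneg _)
      _ ≤ t + 2 * δ := by
          rw [prodExp_const_mul]
          exact mul_le_of_le_one_right (by linarith) (prodExp_abs_sum_le hp h1 h2)
  obtain ⟨J, hJ⟩ : ∃ J : ℝ → ℝ, ∀ w, J w = if |w - c| ≤ t + δ then 1 else 0 := ⟨_, fun _ => rfl⟩
  have lower : ∀ i, (∑ b, p i b * ξ i b ^ 2) *
      prodExp p (fun y => if |∑ j, ξ j (y j) - c| ≤ t then 1 else 0) ≤
      prodExp p (fun y => ξ i (y i) * (F (∑ j, ξ j (y j)) - F (∑ j, ξ j (y j) - ξ i (y i)))) := by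
    intro i
    have hv : 0 ≤ ∑ b, p i b * ξ i b ^ 2 :=
      sum_nonneg fun b _ => mul_nonneg ((hp i).1 b) (sq_nonneg _)
    calc _ ≤ (∑ b, p i b * ξ i b ^ 2) * prodExp p (fun y =>
          J (∑ j, ξ j (y j) - ξ i (y i))) := by
          refine mul_le_mul_of_nonneg_left (prodExp_mono hp fun y => ?_) hv
          have := abs_le.1 (h3 i (y i))
          rw [hJ]
          split_ifs with ha hb
          · exact le_rfl
          · refine absurd ?_ hb
            rw [abs_le] at ha ⊢
            constructor <;> linarith
          · exact zero_le_one
          · exact le_rfl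
      _ = prodExp p (fun y => ξ i (y i) ^ 2 *
          J (∑ j, ξ j (y j) - ξ i (y i))) :=
          (prodExp_mul_sum_sub hp i (fun b => ξ i b ^ 2) J).symm
      _ ≤ _ := by
          refine prodExp_mono hp fun y => ?_
          have hy := abs_le.1 (h3 i (y i))
          rw [hJ]
          split_ifs with ha
          · rw [abs_le] at ha
            rw [hFin _ (abs_le.2 ⟨by linarith, by linarith⟩),
              hFin _ (abs_le.2 ⟨by linarith, by linarith⟩)]
            apply le_of_eq
            ring
          · rw [mul_zero]
            rcases le_total 0 (ξ i (y i)) with h | h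
            · exact mul_nonneg h (sub_nonneg.2 (hFmono (by linarith)))
            · exact mul_nonneg_of_nonpos_of_nonpos h (sub_nonpos.2 (hFmono (by linarith)))
  rw [prodExp_sum_mul hp h1] at upper
  have := (sum_le_sum fun i (_ : i ∈ univ) => lower i).trans upper
  rwa [← sum_mul, h2, one_mul] at this

/-- The normal approximation of a standardized sum of independent variables bounded by `δ` has
error `O(δ)`, uniformly on the real line. -/
theorem berry_esseen_bounded (hp : ∀ i, p i ∈ stdSimplex ℝ B)
    (h1 : ∀ i, ∑ b, p i b * ξ i b = 0) (h2 : ∑ i, ∑ b, p i b * ξ i b ^ 2 = 1) {δ : ℝ}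
    (hδ0 : 0 ≤ δ) (hδ1 : δ ≤ 1) (h3 : ∀ i b, |ξ i b| ≤ δ) (z : ℝ) :
    |prodExp p (fun y => if ∑ j, ξ j (y j) ≤ z then 1 else 0) - gaussianQ (-z)| ≤
      (40 + 2 * millsBound) * δ := by
  have hB := one_le_millsBound
  set v : ι → ℝ := fun i => ∑ b, p i b * ξ i b ^ 2 with hv
  have hv0 : ∀ i, 0 ≤ v i := fun i =>
    sum_nonneg fun b _ => mul_nonneg ((hp i).1 b) (sq_nonneg _)
  -- A common majorant for the two Stein errors; the concentration inequality controls the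
  -- expectation of its indicator.
  set R : ℝ → ℝ := fun w => δ * (2 * |w| + millsBound) + 4 * if |w - z| ≤ δ then 1 else 0 with hR
  have hRE : ∀ i, prodExp p (fun y => R (∑ j, ξ j (y j) - ξ i (y i))) ≤
      (20 + millsBound) * δ := by
    intro i
    calc _ ≤ prodExp p (fun y => δ * (2 * δ + millsBound) + (2 * δ * |∑ j, ξ j (y j)| +
          4 * if |∑ j, ξ j (y j) - z| ≤ 2 * δ then 1 else 0)) := by
          refine prodExp_mono hp fun y => ?_
          have hy := h3 i (y i)
          have e1 : |∑ j, ξ j (y j) - ξ i (y i)| ≤ |∑ j, ξ j (y j)| + δ :=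
            (abs_sub _ _).trans (by linarith)
          have e2 : (if |∑ j, ξ j (y j) - ξ i (y i) - z| ≤ δ then (1 : ℝ) else 0) ≤
              if |∑ j, ξ j (y j) - z| ≤ 2 * δ then 1 else 0 := by
            split_ifs with ha hb
            · exact le_rfl
            · refine absurd ?_ hb
              rw [abs_le] at ha hy ⊢
              constructor <;> linarith
            · exact zero_le_one
            · exact le_rfl
          simp only [hR]
          nlinarith
      _ ≤ δ * (2 * δ + millsBound) + (2 * δ * 1 + 4 * (2 * δ + 2 * δ)) := by
          rw [prodExp_add, prodExp_const hp, prodExp_add, prodExp_const_mul, prodExp_const_mul]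
          have e1 := prodExp_abs_sum_le hp h1 h2
          have e2 := prodExp_concentration hp h1 h2 hδ0 h3 z (t := 2 * δ) (by linarith)
          gcongr
      _ ≤ (20 + millsBound) * δ := by nlinarith
  have hA : ∀ i, |v i * prodExp p (fun y => steinDeriv z (∑ j, ξ j (y j))) -
      v i * prodExp p (fun y => steinDeriv z (∑ j, ξ j (y j) - ξ i (y i)))| ≤
      v i * ((20 + millsBound) * δ) := by
    intro i
    rw [← mul_sub, abs_mul, abs_of_nonneg (hv0 i), ← prodExp_sub]
    refine mul_le_mul_of_nonneg_left (le_trans (abs_prodExp_le hp fun y => ?_) (hRE i)) (hv0 i)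
    have := abs_steinDeriv_sub_le (z := z) (w := ∑ j, ξ j (y j) - ξ i (y i)) (h3 i (y i))
    rw [sub_add_cancel] at this
    refine this.trans ?_
    simp only [hR]
    split_ifs <;> linarith
  have hC : ∀ i, |v i * prodExp p (fun y => steinDeriv z (∑ j, ξ j (y j) - ξ i (y i))) -
      prodExp p (fun y => ξ i (y i) *
        (steinSol z (∑ j, ξ j (y j)) - steinSol z (∑ j, ξ j (y j) - ξ i (y i))))| ≤
      v i * ((20 + millsBound) * δ) := by
    intro i
    refine le_trans ?_ (mul_le_mul_of_nonneg_left (hRE i) (hv0 i))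
    rw [hv, ← prodExp_mul_sum_sub hp i (fun b => ξ i b ^ 2) (steinDeriv z), ← prodExp_sub,
      ← prodExp_mul_sum_sub hp i (fun b => ξ i b ^ 2) R]
    refine abs_prodExp_le hp fun y => ?_
    have := abs_steinSol_taylor_le (z := z) (w := ∑ j, ξ j (y j) - ξ i (y i)) (h3 i (y i))
    rw [sub_add_cancel] at this
    calc _ = |ξ i (y i)| * |steinSol z (∑ j, ξ j (y j)) -
          steinSol z (∑ j, ξ j (y j) - ξ i (y i)) -
          ξ i (y i) * steinDeriv z (∑ j, ξ j (y j) - ξ i (y i))| := by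
          rw [← abs_mul, ← abs_neg]
          congr 1
          ring
      _ ≤ |ξ i (y i)| * (|ξ i (y i)| * R (∑ j, ξ j (y j) - ξ i (y i))) :=
          mul_le_mul_of_nonneg_left this (abs_nonneg _)
      _ = _ := by rw [← mul_assoc, ← sq, sq_abs]
  -- Stein's equation holds at every point, including the kink, because `steinDeriv` is defined by
  -- it.
  have e1 : prodExp p (fun y => if ∑ j, ξ j (y j) ≤ z then 1 else 0) - gaussianQ (-z) =
      prodExp p (fun y => steinDeriv z (∑ j, ξ j (y j))) -
        prodExp p (fun y => (∑ j, ξ j (y j)) * steinSol z (∑ j, ξ j (y j))) := by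
    simp only [steinDeriv]
    rw [prodExp_sub, prodExp_add, prodExp_const hp]
    ring
  have e2 : prodExp p (fun y => if ∑ j, ξ j (y j) ≤ z then 1 else 0) - gaussianQ (-z) =
      ∑ i, ((v i * prodExp p (fun y => steinDeriv z (∑ j, ξ j (y j))) -
          v i * prodExp p (fun y => steinDeriv z (∑ j, ξ j (y j) - ξ i (y i)))) +
        (v i * prodExp p (fun y => steinDeriv z (∑ j, ξ j (y j) - ξ i (y i))) -
          prodExp p (fun y => ξ i (y i) *
            (steinSol z (∑ j, ξ j (y j)) - steinSol z (∑ j, ξ j (y j) - ξ i (y i)))))) := by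
    rw [e1, prodExp_sum_mul hp h1]
    simp only [sub_add_sub_cancel]
    rw [sum_sub_distrib, ← sum_mul, h2, one_mul]
  rw [e2]
  calc _ ≤ ∑ i, v i * (2 * ((20 + millsBound) * δ)) := by
        refine (abs_sum_le_sum_abs _ _).trans (sum_le_sum fun i _ => ?_)
        refine (abs_add_le _ _).trans ?_
        linarith [hA i, hC i]
    _ = (40 + 2 * millsBound) * δ := by
        rw [← sum_mul, h2]
        ring

end BerryEsseen

/-! ### A tail bound for sums of bounded variables -/

section Tail

variable {ι B : Type*} [Fintype ι] [Fintype B] [DecidableEq ι] {p : ι → B → ℝ} {ξ : ι → B → ℝ}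

/-- A Chernoff bound for sums of independent centered variables bounded by one. -/
lemma prodExp_tail_le (hp : ∀ i, p i ∈ stdSimplex ℝ B)
    (h1 : ∀ i, ∑ b, p i b * ξ i b = 0) (h3 : ∀ i b, |ξ i b| ≤ 1) {l : ℝ} (hl0 : 0 ≤ l)
    (hl1 : l ≤ 1) (t : ℝ) :
    prodExp p (fun y => if t < ∑ i, ξ i (y i) then 1 else 0) ≤
      Real.exp (Fintype.card ι * l ^ 2 - l * t) := by
  calc _ ≤ prodExp p (fun y => Real.exp (-(l * t)) * ∏ i, Real.exp (l * ξ i (y i))) := by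
        refine prodExp_mono hp fun y => ?_
        rw [← Real.exp_sum, ← Real.exp_add, ← mul_sum]
        split_ifs with h
        · exact Real.one_le_exp (by nlinarith)
        · exact Real.exp_nonneg _
    _ = Real.exp (-(l * t)) * ∏ i, ∑ b, p i b * Real.exp (l * ξ i b) := by
        rw [prodExp_const_mul, prodExp_prod (fun i b => Real.exp (l * ξ i b))]
    _ ≤ Real.exp (-(l * t)) * ∏ _i : ι, Real.exp (l ^ 2) := by
        refine mul_le_mul_of_nonneg_left (prod_le_prod (fun i _ => sum_nonneg fun b _ =>
          mul_nonneg ((hp i).1 b) (Real.exp_nonneg _)) fun i _ => ?_) (Real.exp_nonneg _)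
        calc ∑ b, p i b * Real.exp (l * ξ i b) ≤
            -- From `exp u ≤ 1 + u + u²` for `|u| ≤ 1`; the linear term then averages to zero.
            ∑ b, (p i b * (1 + l ^ 2) + l * (p i b * ξ i b)) := by
              refine sum_le_sum fun b _ => ?_
              have hb : |l * ξ i b| ≤ 1 := by
                rw [abs_mul, abs_of_nonneg hl0]
                exact mul_le_one₀ hl1 (abs_nonneg _) (h3 i b)
              have h4 := (abs_le.1 (Real.abs_exp_sub_one_sub_id_le hb)).2
              have h5 : (l * ξ i b) ^ 2 ≤ l ^ 2 := by
                rw [mul_pow]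
                exact mul_le_of_le_one_right (sq_nonneg _) ((sq_le_one_iff_abs_le_one _).2 (h3 i b))
              calc p i b * Real.exp (l * ξ i b) ≤ p i b * (1 + l ^ 2 + l * ξ i b) :=
                    mul_le_mul_of_nonneg_left (by linarith) ((hp i).1 b)
                _ = _ := by ring
          _ = 1 + l ^ 2 := by
              rw [sum_add_distrib, ← sum_mul, ← mul_sum, (hp i).2, h1]; ring
          _ ≤ Real.exp (l ^ 2) := by linarith [Real.add_one_le_exp (l ^ 2)]
    _ = _ := by
        rw [prod_const, ← Real.exp_nat_mul, ← Real.exp_add, card_univ]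
        congr 1
        ring

lemma prodExp_abs_tail_le (hp : ∀ i, p i ∈ stdSimplex ℝ B)
    (h1 : ∀ i, ∑ b, p i b * ξ i b = 0) (h3 : ∀ i b, |ξ i b| ≤ 1) {l : ℝ} (hl0 : 0 ≤ l)
    (hl1 : l ≤ 1) (t : ℝ) :
    prodExp p (fun y => if t < |∑ i, ξ i (y i)| then 1 else 0) ≤
      2 * Real.exp (Fintype.card ι * l ^ 2 - l * t) := by
  have ha := prodExp_tail_le hp h1 h3 hl0 hl1 t
  have hb := prodExp_tail_le (ξ := fun i b => -ξ i b) hp (fun i => by simp [h1])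
    (fun i b => by simpa using h3 i b) hl0 hl1 t
  refine le_trans (prodExp_mono hp fun y => ?_) (le_trans (prodExp_add _ _).le
    ((add_le_add ha hb).trans_eq (two_mul _).symm))
  simp only [sum_neg_distrib]
  split_ifs with hc hd he <;> try norm_num
  exact absurd hc (not_lt.2 (abs_le.2 ⟨by linarith, by linarith⟩))

end Tail

/-! ### Expansion of the mutual information in the channel -/

/-- With its quadratic converse `mul_log_div_le`, this places each divergence between zero and a
chi-square distance, once summed over two laws of equal mass. -/
lemma sub_le_mul_log_div {u v : ℝ} (hu : 0 ≤ u) (hv : 0 < v) : u - v ≤ u * Real.log (u / v) := by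
  rcases hu.eq_or_lt with rfl | hu
  · simp [hv.le]
  · have h := Real.log_le_sub_one_of_pos (div_pos hv hu)
    rw [← inv_div, Real.log_inv] at h
    have h2 : u * (u / v)⁻¹ = v := by field_simp
    nlinarith

lemma log_div_le {u v : ℝ} (hu : 0 < u) (hv : 0 < v) : Real.log (u / v) ≤ (u - v) * v⁻¹ := by
  refine (Real.log_le_sub_one_of_pos (div_pos hu hv)).trans_eq ?_
  field_simp

lemma mul_log_div_le {u v : ℝ} (hu : 0 ≤ u) (hv : 0 < v) :
    u * Real.log (u / v) ≤ (u - v) + (u - v) ^ 2 * v⁻¹ := by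
  rcases hu.eq_or_lt with rfl | hu
  · have : v ^ 2 * v⁻¹ = v := by field_simp
    simp [this]
  · refine (mul_le_mul_of_nonneg_left (log_div_le hu hv) hu.le).trans_eq ?_
    field_simp
    ring

section Expansion

variable {X Y : Type*} [Fintype X] [Fintype Y]

/-- The information density, set to zero at input letters of probability zero. -/
def truncDensity (Φ : X → ℝ) (W : X → Y → ℝ) (a : X) (b : Y) : ℝ :=
  if 0 < Φ a then infoDensity Φ W a b else 0

/-- The deviation of the mutual information from its linearization, when the input law deviates
by `τ`, and the channel by `η` at the letters of positive probability. -/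
lemma abs_mutualInfo_sub_le {W P : X → Y → ℝ} {Φ Φ' : X → ℝ} (hW : IsChannel W)
    (hΦ : Φ ∈ stdSimplex ℝ X) (hΦ' : Φ' ∈ stdSimplex ℝ X) (hP0 : ∀ a b, 0 ≤ P a b)
    (hP1 : ∀ a, 0 < Φ' a → ∑ b, P a b = 1) (hPW : ∀ a b, 0 < Φ' a * P a b → 0 < W a b)
    {τ η : ℝ} (hτ : 0 < τ) (hτ1 : τ ≤ 1) (hη : 0 ≤ η) (hΦΦ' : ∀ a, |Φ a - Φ' a| ≤ τ)
    (hmin : ∀ a b, 0 < Φ' a * P a b → τ ≤ Φ' a * P a b)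
    (hdev : ∀ a b, 0 < Φ a → |P a b - W a b| ≤ η) :
    |mutualInfo Φ' P - ∑ a, ∑ b, Φ' a * P a b * truncDensity Φ W a b| ≤
      Fintype.card X * τ * Real.log τ⁻¹ + η ^ 2 * ∑ a, ∑ b, (W a b)⁻¹ +
      (Fintype.card X * (η + τ)) ^ 2 * ∑ b, (outDist Φ W b)⁻¹ +
      Fintype.card X * τ * ∑ b, (1 + (outDist Φ W b)⁻¹) := by
  have hΦ'1 : ∀ a, Φ' a ≤ 1 := fun a => by
    rw [← hΦ'.2]; exact single_le_sum (fun i _ => hΦ'.1 i) (mem_univ a)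
  have hJ0 : ∀ a b, 0 ≤ Φ' a * P a b := fun a b => mul_nonneg (hΦ'.1 a) (hP0 a b)
  have hJs : ∀ a, ∑ b, Φ' a * P a b = Φ' a := fun a => by
    rcases (hΦ'.1 a).eq_or_lt with h | h
    · simp [← h]
    · rw [← mul_sum, hP1 a h, mul_one]
  have hP1' : ∀ a b, 0 < Φ' a → P a b ≤ 1 := fun a b h => by
    rw [← hP1 a h]; exact single_le_sum (fun i _ => hP0 a i) (mem_univ b)
  have hJΦ : ∀ a b, Φ' a * P a b ≤ Φ' a := fun a b => by
    rcases (hΦ'.1 a).eq_or_lt with h | h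
    · simp [← h]
    · exact mul_le_of_le_one_right h.le (hP1' a b h)
  set q : Y → ℝ := outDist Φ' P with hq
  set q₀ : Y → ℝ := outDist Φ W with hq₀
  -- The part of the output law coming from letters of positive `Φ`-probability. It differs from `q`
  -- by at most `|X| τ`.
  set qA : Y → ℝ := fun b => ∑ a, if 0 < Φ a then Φ' a * P a b else 0 with hqA
  have hJq : ∀ a b, Φ' a * P a b ≤ q b := fun a b =>
    single_le_sum (f := fun a => Φ' a * P a b) (fun i _ => hJ0 i b) (mem_univ a)
  have hq0 : ∀ b, 0 ≤ q b := fun b => sum_nonneg fun a _ => hJ0 a b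
  have hqs : ∑ b, q b = 1 := by
    simp only [hq, outDist]
    rw [sum_comm, ← hΦ'.2]
    exact sum_congr rfl fun a _ => hJs a
  have hq1 : ∀ b, q b ≤ 1 := fun b => by
    rw [← hqs]; exact single_le_sum (fun i _ => hq0 i) (mem_univ b)
  have hq₀0 : ∀ b, 0 ≤ q₀ b := fun b => sum_nonneg fun a _ => mul_nonneg (hΦ.1 a) ((hW a).1 b)
  have hq₀s : ∑ b, q₀ b = 1 := by
    simp only [hq₀, outDist]
    rw [sum_comm, ← hΦ.2]
    exact sum_congr rfl fun a _ => by rw [← mul_sum, (hW a).2, mul_one]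
  have hWq₀ : ∀ a b, 0 < Φ a → 0 < W a b → 0 < q₀ b := fun a b h h' =>
    lt_of_lt_of_le (mul_pos h h') (single_le_sum (f := fun a => Φ a * W a b)
      (fun i _ => mul_nonneg (hΦ.1 i) ((hW i).1 b)) (mem_univ a))
  have hsmall : ∀ a, ¬ 0 < Φ a → Φ' a ≤ τ := fun a h => by
    have h0 : Φ a = 0 := le_antisymm (not_lt.1 h) (hΦ.1 a)
    have := hΦΦ' a
    rw [h0, zero_sub, abs_neg] at this
    exact (le_abs_self _).trans this
  have hqA0 : ∀ b, 0 ≤ qA b := fun b => sum_nonneg fun a _ => by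
    split_ifs
    exacts [hJ0 a b, le_rfl]
  have hqAle : ∀ b, qA b ≤ q b := fun b => sum_le_sum fun a _ => by
    split_ifs
    exacts [le_rfl, hJ0 a b]
  have hcard : ∀ c : ℝ, ∑ _a : X, c = Fintype.card X * c := fun c => by simp
  have hqqA : ∀ b, q b - qA b ≤ Fintype.card X * τ := fun b => by
    rw [← hcard, hq, outDist, hqA, ← sum_sub_distrib]
    refine sum_le_sum fun a _ => ?_
    split_ifs with h
    · simpa using hτ.le
    · rw [sub_zero]
      exact (hJΦ a b).trans (hsmall a h)
  have hterm : ∀ a b, 0 < Φ a → |Φ' a * P a b - Φ a * W a b| ≤ η + τ := fun a b h => by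
    have hW1 : W a b ≤ 1 := by
      rw [← (hW a).2]; exact single_le_sum (fun i _ => (hW a).1 i) (mem_univ b)
    have e : Φ' a * P a b - Φ a * W a b =
        Φ' a * (P a b - W a b) - (Φ a - Φ' a) * W a b := by ring
    rw [e]
    refine (abs_sub _ _).trans ?_
    rw [abs_mul, abs_mul, abs_of_nonneg (hΦ'.1 a), abs_of_nonneg ((hW a).1 b)]
    refine add_le_add ?_ ?_
    · exact (mul_le_of_le_one_left (abs_nonneg _) (hΦ'1 a)).trans (hdev a b h)
    · exact (mul_le_of_le_one_right (abs_nonneg _) hW1).trans (hΦΦ' a)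
  have hq₀term : ∀ a b, ¬ 0 < Φ a → Φ a * W a b = 0 := fun a b h => by
    rw [le_antisymm (not_lt.1 h) (hΦ.1 a), zero_mul]
  have hqdev : ∀ b, |q b - q₀ b| ≤ Fintype.card X * (η + τ) := fun b => by
    rw [← hcard, hq, hq₀, outDist, outDist, ← sum_sub_distrib]
    refine (abs_sum_le_sum_abs _ _).trans (sum_le_sum fun a _ => ?_)
    by_cases h : 0 < Φ a
    · exact hterm a b h
    · rw [hq₀term a b h, sub_zero, abs_of_nonneg (hJ0 a b)]
      linarith [(hJΦ a b).trans (hsmall a h)]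
  have hqAdev : ∀ b, |qA b - q₀ b| ≤ Fintype.card X * (η + τ) := fun b => by
    rw [← hcard, hqA, hq₀, outDist, ← sum_sub_distrib]
    refine (abs_sum_le_sum_abs _ _).trans (sum_le_sum fun a _ => ?_)
    split_ifs with h
    · exact hterm a b h
    · rw [hq₀term a b h, sub_zero, abs_zero]
      linarith
  have hlog : 0 ≤ Real.log τ⁻¹ := Real.log_nonneg ((one_le_inv₀ hτ).2 hτ1)
  have hW0P : ∀ a b, ¬ 0 < W a b → Φ' a * P a b = 0 ∧ W a b = 0 := fun a b h =>
    ⟨le_antisymm (not_lt.1 fun h' => h (hPW a b h')) (hJ0 a b),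
      le_antisymm (not_lt.1 h) ((hW a).1 b)⟩
  -- the letters of probability zero
  have hS : |∑ a, ∑ b, (if 0 < Φ a then 0 else Φ' a * P a b * infoDensity Φ' P a b)| ≤
      Fintype.card X * τ * Real.log τ⁻¹ := by
    rw [mul_assoc, ← hcard]
    refine (abs_sum_le_sum_abs _ _).trans (sum_le_sum fun a _ => ?_)
    split_ifs with h
    · rw [sum_const_zero, abs_zero]
      exact mul_nonneg hτ.le hlog
    · refine (abs_sum_le_sum_abs _ _).trans ((sum_le_sum fun b _ => ?_ :
        _ ≤ ∑ b, Φ' a * P a b * Real.log τ⁻¹).trans ?_)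
      · rw [abs_mul, abs_of_nonneg (hJ0 a b)]
        rcases (hJ0 a b).eq_or_lt with hJ | hJ
        · simp [← hJ]
        · refine mul_le_mul_of_nonneg_left ?_ hJ.le
          have hΦp : 0 < Φ' a := pos_of_mul_pos_left hJ (hP0 a b)
          have hPτ : τ ≤ P a b :=
            (hmin a b hJ).trans (mul_le_of_le_one_left (hP0 a b) (hΦ'1 a))
          have hqτ : τ ≤ q b := (hmin a b hJ).trans (hJq a b)
          have l1 := Real.log_le_log hτ hPτ
          have l2 := Real.log_le_log hτ hqτ
          have l3 := Real.log_nonpos (hP0 a b) (hP1' a b hΦp)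
          have l4 := Real.log_nonpos (hq0 b) (hq1 b)
          rw [infoDensity, ← hq, Real.log_div (hτ.trans_le hPτ).ne' (hτ.trans_le hqτ).ne',
            Real.log_inv, abs_le]
          constructor <;> linarith
      · rw [← sum_mul, hJs]
        exact mul_le_mul_of_nonneg_right (hsmall a h) hlog
  -- the divergence of the channels
  have hT1 : ∀ a b, (if 0 < Φ a then Φ' a * P a b * Real.log (P a b / W a b) else 0) ≤
      (if 0 < Φ a then Φ' a * (P a b - W a b) else 0) + η ^ 2 * (W a b)⁻¹ := by
    intro a b
    by_cases hw : 0 < W a b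
    · have hwi : 0 ≤ (W a b)⁻¹ := inv_nonneg.2 hw.le
      split_ifs with h
      · have h1 := mul_log_div_le (hP0 a b) hw
        have h2 : (P a b - W a b) ^ 2 ≤ η ^ 2 := sq_le_sq.2 ((hdev a b h).trans (le_abs_self η))
        calc Φ' a * P a b * Real.log (P a b / W a b)
            = Φ' a * (P a b * Real.log (P a b / W a b)) := by ring
          _ ≤ Φ' a * ((P a b - W a b) + η ^ 2 * (W a b)⁻¹) :=
              mul_le_mul_of_nonneg_left (h1.trans (by gcongr)) (hΦ'.1 a)
          _ = Φ' a * (P a b - W a b) + Φ' a * (η ^ 2 * (W a b)⁻¹) := by ring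
          _ ≤ _ := by
              have := mul_le_of_le_one_left (mul_nonneg (sq_nonneg η) hwi) (hΦ'1 a)
              linarith
      · rw [zero_add]
        exact mul_nonneg (sq_nonneg η) hwi
    · obtain ⟨e1, e2⟩ := hW0P a b hw
      rw [mul_sub, e1, e2]
      simp
  have hT1' : ∀ a b, (if 0 < Φ a then Φ' a * (P a b - W a b) else 0) ≤
      (if 0 < Φ a then Φ' a * P a b * Real.log (P a b / W a b) else 0) := by
    intro a b
    split_ifs with h
    · by_cases hw : 0 < W a b
      · rw [mul_assoc]
        exact mul_le_mul_of_nonneg_left (sub_le_mul_log_div (hP0 a b) hw) (hΦ'.1 a)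
      · obtain ⟨e1, e2⟩ := hW0P a b hw
        rw [mul_sub, e1, e2]
        simp
    · exact le_rfl
  have hT1s : ∑ a, ∑ b, (if 0 < Φ a then Φ' a * (P a b - W a b) else 0) = 0 := by
    refine sum_eq_zero fun a _ => ?_
    split_ifs
    · rw [← mul_sum, sum_sub_distrib, mul_sub, mul_sum, hJs, (hW a).2]; ring
    · simp
  -- the divergence of the output laws
  have hT2 : ∀ b, qA b * Real.log (q b / q₀ b) ≤
      (q b - q₀ b) + (Fintype.card X * (η + τ)) ^ 2 * (q₀ b)⁻¹ := by
    intro b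
    rcases (hq₀0 b).eq_or_lt with h | h
    · simpa [← h] using hq0 b
    rcases (hqA0 b).eq_or_lt with hz | hz
    · have h1 := hqdev b
      have h2 := hqAdev b
      rw [← hz, zero_sub, abs_neg, abs_of_pos h] at h2
      have h3 : q₀ b = q₀ b ^ 2 * (q₀ b)⁻¹ := by field_simp
      have h4 : q₀ b ^ 2 * (q₀ b)⁻¹ ≤ (Fintype.card X * (η + τ)) ^ 2 * (q₀ b)⁻¹ := by gcongr
      rw [← hz, zero_mul]
      linarith [hq0 b]
    · have h1 := mul_le_mul_of_nonneg_left (log_div_le (hz.trans_le (hqAle b)) h) hz.le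
      have h2 : (qA b - q₀ b) * (q b - q₀ b) ≤ (Fintype.card X * (η + τ)) ^ 2 := by
        refine (le_abs_self _).trans ?_
        rw [abs_mul, sq]
        exact mul_le_mul (hqAdev b) (hqdev b) (abs_nonneg _) (by positivity)
      have h3 := mul_le_mul_of_nonneg_right h2 (inv_nonneg.2 h.le)
      have h4 : qA b * ((q b - q₀ b) * (q₀ b)⁻¹) =
          (q b - q₀ b) + (qA b - q₀ b) * (q b - q₀ b) * (q₀ b)⁻¹ := by
        field_simp
        ring
      linarith
  -- Replacing `qA` by `q` costs at most `|X| τ` times `log (q / q₀) ≤ 1 / q₀`. The summand 1 covers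
  -- `q₀ b = 0`, where `qA b` vanishes and `q b ≤ |X| τ`.
  have hT2' : ∀ b, (q b - q₀ b) - Fintype.card X * τ * (1 + (q₀ b)⁻¹) ≤
      qA b * Real.log (q b / q₀ b) := by
    intro b
    have hX : 0 ≤ Fintype.card X * τ := by positivity
    rcases (hq₀0 b).eq_or_lt with h | h
    · have : qA b = 0 := by
        refine sum_eq_zero fun a _ => ?_
        split_ifs with ha
        · exact (hW0P a b fun hw => (hWq₀ a b ha hw).ne h).1
        · rfl
      have h2 := hqqA b
      rw [this] at h2
      rw [this, ← h]
      simp only [inv_zero, zero_mul]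
      linarith
    · have h1 := sub_le_mul_log_div (hq0 b) h
      have h2 : (q b - qA b) * Real.log (q b / q₀ b) ≤
          Fintype.card X * τ * (1 + (q₀ b)⁻¹) := by
        have h3 : Real.log (q b / q₀ b) ≤ 1 + (q₀ b)⁻¹ := by
          refine (Real.log_le_self (div_nonneg (hq0 b) h.le)).trans ?_
          rw [div_eq_mul_inv]
          have := mul_le_of_le_one_left (inv_nonneg.2 h.le) (hq1 b)
          linarith
        have h4 : 0 ≤ 1 + (q₀ b)⁻¹ := add_nonneg zero_le_one (inv_nonneg.2 h.le)
        exact (mul_le_mul_of_nonneg_left h3 (sub_nonneg.2 (hqAle b))).trans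
          (mul_le_mul_of_nonneg_right (hqqA b) h4)
      linarith
  -- On letters with `Φ a > 0`, `log (P/q) - log (W/q₀) = log (P/W) - log (q/q₀)`; the other letters
  -- are kept whole.
  have hdecomp : mutualInfo Φ' P - ∑ a, ∑ b, Φ' a * P a b * truncDensity Φ W a b =
      ∑ a, ∑ b, (if 0 < Φ a then 0 else Φ' a * P a b * infoDensity Φ' P a b) +
      ∑ a, ∑ b, (if 0 < Φ a then Φ' a * P a b * Real.log (P a b / W a b) else 0) -
      ∑ b, qA b * Real.log (q b / q₀ b) := by
    have e : ∑ b, qA b * Real.log (q b / q₀ b) = ∑ a, ∑ b,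
        (if 0 < Φ a then Φ' a * P a b * Real.log (q b / q₀ b) else 0) := by
      rw [sum_comm]
      refine sum_congr rfl fun b _ => ?_
      rw [hqA, sum_mul]
      exact sum_congr rfl fun a _ => by split_ifs <;> simp
    rw [e, mutualInfo]
    simp only [← sum_sub_distrib, ← sum_add_distrib]
    refine sum_congr rfl fun a _ => sum_congr rfl fun b _ => ?_
    unfold truncDensity
    split_ifs with h
    · rcases (hJ0 a b).eq_or_lt with hJ | hJ
      · simp [← hJ]
      · have hWp := hPW a b hJ
        have hPp : 0 < P a b := pos_of_mul_pos_right hJ (hΦ'.1 a)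
        have hqp : 0 < q b := lt_of_lt_of_le hJ (hJq a b)
        have hq₀p := hWq₀ a b h hWp
        simp only [infoDensity, ← hq, ← hq₀]
        rw [Real.log_div hPp.ne' hqp.ne', Real.log_div hPp.ne' hWp.ne',
          Real.log_div hqp.ne' hq₀p.ne', Real.log_div hWp.ne' hq₀p.ne']
        ring
    · ring
  have hT1u := sum_le_sum fun a (_ : a ∈ univ) => sum_le_sum fun b (_ : b ∈ univ) => hT1 a b
  have hT1l := sum_le_sum fun a (_ : a ∈ univ) => sum_le_sum fun b (_ : b ∈ univ) => hT1' a b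
  have hT2u := sum_le_sum fun b (_ : b ∈ univ) => hT2 b
  have hT2l := sum_le_sum fun b (_ : b ∈ univ) => hT2' b
  simp only [sum_add_distrib, sum_sub_distrib, ← mul_sum, hT1s, hqs, hq₀s] at hT1u hT1l hT2u hT2l
  have hS' := abs_le.1 hS
  rw [hdecomp, abs_le]
  simp only [sum_add_distrib]
  have p1 : 0 ≤ η ^ 2 * ∑ a, ∑ b, (W a b)⁻¹ := mul_nonneg (sq_nonneg _)
    (sum_nonneg fun a _ => sum_nonneg fun b _ => inv_nonneg.2 ((hW a).1 b))
  have p2 : 0 ≤ (Fintype.card X * (η + τ)) ^ 2 * ∑ b, (q₀ b)⁻¹ := mul_nonneg (sq_nonneg _)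
    (sum_nonneg fun b _ => inv_nonneg.2 (hq₀0 b))
  have p3 : 0 ≤ Fintype.card X * τ * (∑ _b : Y, (1 : ℝ) + ∑ b, (q₀ b)⁻¹) :=
    mul_nonneg (by positivity) (add_nonneg (by simp)
    (sum_nonneg fun b _ => inv_nonneg.2 (hq₀0 b)))
  constructor <;> linarith [hS'.1, hS'.2]

end Expansion

variable {X Y : Type*} [Fintype X] [Fintype Y] [DecidableEq X] [DecidableEq Y]

/-! ### Empirical distributions -/

omit [Fintype X] [DecidableEq X] [DecidableEq Y] in
lemma outputProb_eq_prodExp {n : ℕ} (W : X → Y → ℝ) (x : Fin n → X) (E : Set (Fin n → Y)) :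
    outputProb W x E = prodExp (fun i => W (x i)) (E.indicator fun _ => 1) := by
  refine sum_congr rfl fun y _ => ?_
  by_cases h : y ∈ E <;> simp [h]

lemma sum_comp_eq_sum_count {n : ℕ} (x : Fin n → X) (f : X → ℝ) :
    ∑ i, f (x i) = ∑ a, (count x a : ℝ) * f a := by
  rw [← sum_fiberwise' univ x f]
  simp [count]

lemma sum_comp_eq_sum_jointCount {n : ℕ} (x : Fin n → X) (y : Fin n → Y) (f : X → Y → ℝ) :
    ∑ i, f (x i) (y i) = ∑ a, ∑ b, (jointCount x y a b : ℝ) * f a b := by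
  rw [← Fintype.sum_prod_type' fun a b => (jointCount x y a b : ℝ) * f a b,
    ← sum_fiberwise' univ (fun i => (x i, y i)) fun c => f c.1 c.2]
  simp [jointCount, Prod.ext_iff]

omit [Fintype X] in
lemma sum_jointCount {n : ℕ} (x : Fin n → X) (y : Fin n → Y) (a : X) :
    ∑ b, (jointCount x y a b : ℝ) = count x a := by
  have h := card_eq_sum_card_fiberwise (s := {i | x i = a}) (t := univ) (f := y)
    fun _ _ => mem_coe.2 (mem_univ _)
  simp only [filter_filter] at h
  rw [count, h]
  simp [jointCount]

omit [Fintype X] [Fintype Y] in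
lemma jointCount_le_count {n : ℕ} (x : Fin n → X) (y : Fin n → Y) (a : X) (b : Y) :
    jointCount x y a b ≤ count x a :=
  card_le_card fun i hi => by
    simp only [mem_filter, mem_univ, true_and] at hi ⊢
    exact hi.1

omit [Fintype X] [Fintype Y] in
lemma count_mul_condType {n : ℕ} (x : Fin n → X) (y : Fin n → Y) (a : X) (b : Y) :
    (count x a : ℝ) * condType x y a b = jointCount x y a b := by
  rw [condType]
  rcases Nat.eq_zero_or_pos (count x a) with h | h
  -- For an absent letter the joint count is zero, so the default value of the quotient is harmless.
  · have := jointCount_le_count x y a b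
    rw [h, Nat.le_zero] at this
    simp [h, this]
  · have : (count x a : ℝ) ≠ 0 := by exact_mod_cast h.ne'
    field_simp

/-- The centered indicator of the output letter `b` at the positions of the input letter `a`. -/
def centeredIndicator (W : X → Y → ℝ) (a : X) (b : Y) (a' : X) (c : Y) : ℝ :=
  if a' = a then (if c = b then 1 else 0) - W a b else 0

omit [Fintype X] [Fintype Y] in
lemma sum_centeredIndicator {n : ℕ} (W : X → Y → ℝ) (x : Fin n → X) (y : Fin n → Y) (a : X)
    (b : Y) : ∑ i, centeredIndicator W a b (x i) (y i) =
      jointCount x y a b - count x a * W a b := by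
  have h : ∀ i, centeredIndicator W a b (x i) (y i) =
      (if x i = a ∧ y i = b then 1 else 0) - (if x i = a then 1 else 0) * W a b := fun i => by
    unfold centeredIndicator
    by_cases h1 : x i = a <;> by_cases h2 : y i = b <;> simp [h1, h2]
  simp only [h, sum_sub_distrib, ← sum_mul]
  simp [jointCount, count]

omit [Fintype X] in
lemma sum_mul_centeredIndicator {W : X → Y → ℝ} (hW : IsChannel W) (a : X) (b : Y) (a' : X) :
    ∑ c, W a' c * centeredIndicator W a b a' c = 0 := by
  unfold centeredIndicator
  split_ifs with h
  · subst h
    simp [mul_sub, ← sum_mul, (hW a').2]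
  · simp

omit [Fintype X] [DecidableEq X] [DecidableEq Y] in
lemma IsChannel.le_one {W : X → Y → ℝ} (hW : IsChannel W) (a : X) (b : Y) : W a b ≤ 1 := by
  rw [← (hW a).2]; exact single_le_sum (fun i _ => (hW a).1 i) (mem_univ b)

omit [Fintype X] in
lemma abs_centeredIndicator_le {W : X → Y → ℝ} (hW : IsChannel W) (a : X) (b : Y) (a' : X)
    (c : Y) : |centeredIndicator W a b a' c| ≤ 1 := by
  have h0 := (hW a).1 b
  have h1 := hW.le_one a b
  unfold centeredIndicator
  rw [abs_le]
  split_ifs <;> constructor <;> linarith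

omit [Fintype Y] [DecidableEq X] [DecidableEq Y] in
lemma exists_pos_le_of_pos (Φ : X → ℝ) : ∃ φ > 0, ∀ a, 0 < Φ a → φ ≤ Φ a := by
  rcases (univ.filter fun a => 0 < Φ a).eq_empty_or_nonempty with h | h
  · refine ⟨1, one_pos, fun a ha => ?_⟩
    have : a ∈ univ.filter fun a => 0 < Φ a := mem_filter.2 ⟨mem_univ a, ha⟩
    rw [h] at this
    exact absurd this (notMem_empty a)
  · obtain ⟨a, ha, hmin⟩ := exists_min_image _ Φ h
    exact ⟨Φ a, (mem_filter.1 ha).2, fun b hb => hmin b (mem_filter.2 ⟨mem_univ b, hb⟩)⟩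

omit [Fintype X] [Fintype Y] [DecidableEq Y] in
lemma count_eq_of_mem_typeClass {n : ℕ} (hn : n ≠ 0) {P : X → ℝ} {x : Fin n → X}
    (hx : x ∈ typeClass n P) (a : X) : (count x a : ℝ) = n * P a := by
  have : (n : ℝ) ≠ 0 := Nat.cast_ne_zero.2 hn
  rw [hx a]
  field_simp

omit [Fintype Y] [DecidableEq X] [DecidableEq Y] in
lemma abs_sub_le_of_norm_le {Φ Φn : X → ℝ} {τ : ℝ} (h : ‖Φ - Φn‖ ≤ τ) (a : X) :
    |Φ a - Φn a| ≤ τ := (norm_le_pi_norm (Φ - Φn) a).trans h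

omit [Fintype Y] [DecidableEq Y] in
/-- The empirical mean of `f` is within `O(1 / n)` of its expectation. -/
lemma abs_sum_comp_sub_le {n : ℕ} (hn : n ≠ 0) {Φ Φn : X → ℝ} (hΦn : ‖Φ - Φn‖ ≤ 1 / (n : ℝ))
    {x : Fin n → X} (hx : x ∈ typeClass n Φn) (f : X → ℝ) :
    |∑ i, f (x i) - n * ∑ a, Φ a * f a| ≤ ∑ a, |f a| := by
  have hn' : (0 : ℝ) < n := Nat.cast_pos.2 (Nat.pos_of_ne_zero hn)
  rw [sum_comp_eq_sum_count, mul_sum, ← sum_sub_distrib]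
  refine (abs_sum_le_sum_abs _ _).trans (sum_le_sum fun a _ => ?_)
  rw [count_eq_of_mem_typeClass hn hx, ← mul_assoc, ← sub_mul, ← mul_sub, abs_mul, abs_mul,
    abs_sub_comm, abs_of_pos hn']
  have := mul_le_mul_of_nonneg_left (abs_sub_le_of_norm_le hΦn a) hn'.le
  rw [mul_one_div_cancel hn'.ne'] at this
  exact mul_le_of_le_one_left (abs_nonneg _) this

/-- On typical outputs the empirical mutual information is the average of the information
densities up to `O(log n / n)`. -/
lemma abs_mutualInfo_condType_sub_le {W : X → Y → ℝ} (hW : IsChannel W) {Φ : X → ℝ}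
    (hΦ : Φ ∈ stdSimplex ℝ X) : ∃ (C : ℝ) (N : ℕ), ∀ n ≥ N, ∀ Φn ∈ nTypes X n,
      ‖Φ - Φn‖ ≤ 1 / (n : ℝ) → ∀ x ∈ typeClass n Φn, ∀ y : Fin n → Y,
      (∀ i, 0 < W (x i) (y i)) →
      (∀ a b, |(jointCount x y a b : ℝ) - count x a * W a b| ≤ 2 * √(n * Real.log n)) →
      |n * mutualInfo Φn (condType x y) - ∑ i, truncDensity Φ W (x i) (y i)| ≤
        C * Real.log n := by
  obtain ⟨φ, hφ, hφΦ⟩ := exists_pos_le_of_pos Φ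
  set K₁ := ∑ a, ∑ b, (W a b)⁻¹ with hK₁
  set K₂ := ∑ b, (outDist Φ W b)⁻¹ with hK₂
  set K₃ := ∑ b, (1 + (outDist Φ W b)⁻¹) with hK₃
  set k : ℝ := (Fintype.card X : ℝ) with hk
  have hq0 : ∀ b, 0 ≤ (outDist Φ W b)⁻¹ := fun b => inv_nonneg.2
    (sum_nonneg fun a _ => mul_nonneg (hΦ.1 a) ((hW a).1 b))
  have hK₂0 : 0 ≤ K₂ := sum_nonneg fun b _ => hq0 b
  have hK₃0 : 0 ≤ K₃ := sum_nonneg fun b _ => add_nonneg zero_le_one (hq0 b)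
  refine ⟨k + 16 / φ ^ 2 * K₁ + 2 * k ^ 2 * (16 / φ ^ 2 + 1) * K₂ + k * K₃, max 3 ⌈2 / φ⌉₊,
    fun n hn Φn hΦn hΦΦn x hx y hy htyp => ?_⟩
  have hn3 : 3 ≤ n := (le_max_left _ _).trans hn
  have hn0 : n ≠ 0 := by omega
  have hnφ : 2 ≤ n * φ := by
    have : 2 / φ ≤ n := (Nat.le_ceil _).trans (by exact_mod_cast (le_max_right _ _).trans hn)
    rwa [div_le_iff₀ hφ] at this
  have hnp : (0 : ℝ) < n := by positivity
  have hlog : 1 ≤ Real.log n := by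
    rw [Real.le_log_iff_exp_le hnp]
    exact Real.exp_one_lt_three.le.trans (by exact_mod_cast hn3)
  -- The count deviation `2√(n log n)` divided by the lower bound `n φ / 2` for the count of a
  -- letter with `Φ a > 0`.
  set η : ℝ := 4 / φ * √(Real.log n / n) with hη
  have hη2 : η ^ 2 = 16 / φ ^ 2 * (Real.log n / n) := by
    rw [hη, mul_pow, Real.sq_sqrt (by positivity)]
    ring
  have hcount := count_eq_of_mem_typeClass hn0 hx
  have hJ : ∀ a b, Φn a * condType x y a b = jointCount x y a b / n := fun a b => by
    rw [← count_mul_condType, hcount]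
    field_simp
  have hpos : ∀ a b, 0 < Φn a * condType x y a b → 1 ≤ jointCount x y a b := fun a b h => by
    rw [hJ] at h
    by_contra hc
    have : jointCount x y a b = 0 := by omega
    simp [this] at h
  have hmain := abs_mutualInfo_sub_le (P := condType x y) hW hΦ hΦn.1
    (fun a b => by unfold condType; positivity)
    (fun a ha => by
      have hc : (0 : ℝ) < count x a := by rw [hcount]; positivity
      simp only [condType]
      rw [← sum_div, sum_jointCount, div_self hc.ne'])
    (fun a b h => by
      obtain ⟨i, hi⟩ := card_pos.1 (hpos a b h)
      simp only [mem_filter, mem_univ, true_and] at hi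
      rw [← hi.1, ← hi.2]
      exact hy i)
    -- The same `1/n` bounds the distance of the input laws and, counts being integers, the least
    -- positive joint mass.
    (τ := 1 / n) (η := η) (by positivity)
    (by rw [div_le_one hnp]; exact_mod_cast (by omega : 1 ≤ n)) (by positivity)
    (abs_sub_le_of_norm_le hΦΦn)
    (fun a b h => by
      rw [hJ]
      gcongr
      exact_mod_cast hpos a b h)
    (fun a b ha => by
      have h1 := (abs_le.1 (abs_sub_le_of_norm_le hΦΦn a)).2
      have h2 : n * φ / 2 ≤ count x a := by
        rw [hcount]
        have h3 : n * (Φ a - Φn a) ≤ n * (1 / n) := mul_le_mul_of_nonneg_left h1 hnp.le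
        have h4 : n * φ ≤ n * Φ a := mul_le_mul_of_nonneg_left (hφΦ a ha) hnp.le
        rw [mul_one_div_cancel hnp.ne'] at h3
        linarith
      have hc : (0 : ℝ) < count x a := by linarith
      have e : condType x y a b - W a b =
          ((jointCount x y a b : ℝ) - count x a * W a b) / count x a := by
        rw [condType]; field_simp
      rw [e, abs_div, abs_of_pos hc, div_le_iff₀ hc]
      refine (htyp a b).trans ?_
      have h5 : √(n * Real.log n) = n * √(Real.log n / n) := by
        rw [← Real.sqrt_sq hnp.le, ← Real.sqrt_mul (sq_nonneg _), Real.sqrt_sq hnp.le]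
        congr 1
        field_simp
      calc 2 * √(n * Real.log n) = η * (n * φ / 2) := by
            rw [h5, hη]; field_simp; ring
        _ ≤ η * count x a := mul_le_mul_of_nonneg_left h2 (by positivity))
  have hsum : ∑ i, truncDensity Φ W (x i) (y i) =
      n * ∑ a, ∑ b, Φn a * condType x y a b * truncDensity Φ W a b := by
    rw [sum_comp_eq_sum_jointCount, mul_sum]
    refine sum_congr rfl fun a _ => ?_
    rw [mul_sum]
    refine sum_congr rfl fun b _ => ?_
    rw [hJ]
    field_simp
  rw [hsum, ← mul_sub, abs_mul, abs_of_pos hnp]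
  refine (mul_le_mul_of_nonneg_left hmain hnp.le).trans ?_
  have hsq : (k * (η + 1 / n)) ^ 2 ≤ 2 * k ^ 2 * (16 / φ ^ 2 + 1) * (Real.log n / n) := by
    have h1 : (1 / (n : ℝ)) ^ 2 ≤ Real.log n / n := by
      rw [one_div, sq, div_eq_mul_inv]
      refine mul_le_mul_of_nonneg_right (le_trans ?_ hlog) (by positivity)
      exact inv_le_one_of_one_le₀ (by exact_mod_cast (by omega : 1 ≤ n))
    have h2 : (η + 1 / n) ^ 2 ≤ 2 * (η ^ 2 + (1 / (n : ℝ)) ^ 2) := by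
      nlinarith [sq_nonneg (η - 1 / (n : ℝ))]
    calc (k * (η + 1 / n)) ^ 2 = k ^ 2 * (η + 1 / n) ^ 2 := by ring
      _ ≤ k ^ 2 * (2 * (16 / φ ^ 2 * (Real.log n / n) + Real.log n / n)) := by
          refine mul_le_mul_of_nonneg_left (h2.trans ?_) (sq_nonneg _)
          rw [hη2]
          linarith
      _ = _ := by ring
  have e1 : (1 / (n : ℝ))⁻¹ = n := by simp
  rw [e1, hη2]
  calc _ ≤ n * (k * (1 / n) * Real.log n + 16 / φ ^ 2 * (Real.log n / n) * K₁ +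
        2 * k ^ 2 * (16 / φ ^ 2 + 1) * (Real.log n / n) * K₂ +
          k * (1 / n) * (K₃ * Real.log n)) := by
        gcongr
        exact le_mul_of_one_le_right hK₃0 hlog
    _ = _ := by field_simp

/-! ### Normal approximation of the probability of a fall of the mutual information -/

/-- The conditional mean of the information density given the input letter. -/
def condMean (Φ : X → ℝ) (W : X → Y → ℝ) (a : X) : ℝ := ∑ b, W a b * truncDensity Φ W a b

/-- The conditional variance of the information density given the input letter. -/
def condVar (Φ : X → ℝ) (W : X → Y → ℝ) (a : X) : ℝ :=
  ∑ b, W a b * (truncDensity Φ W a b - condMean Φ W a) ^ 2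

omit [DecidableEq X] [DecidableEq Y] in
lemma mutualInfo_eq_sum_condMean {W : X → Y → ℝ} {Φ : X → ℝ} (hΦ : Φ ∈ stdSimplex ℝ X) :
    mutualInfo Φ W = ∑ a, Φ a * condMean Φ W a := by
  refine sum_congr rfl fun a _ => ?_
  rw [condMean, mul_sum]
  refine sum_congr rfl fun b _ => ?_
  rcases (hΦ.1 a).eq_or_lt with h | h
  · simp [← h]
  · rw [truncDensity, if_pos h, mul_assoc]

omit [DecidableEq X] [DecidableEq Y] in
lemma condInfoVar_eq_sum_condVar {W : X → Y → ℝ} (hW : IsChannel W) {Φ : X → ℝ}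
    (hΦ : Φ ∈ stdSimplex ℝ X) : condInfoVar Φ W = ∑ a, Φ a * condVar Φ W a := by
  refine sum_congr rfl fun a _ => ?_
  rcases (hΦ.1 a).eq_or_lt with h | h
  · simp [← h]
  · have e : ∀ b, W a b * (truncDensity Φ W a b - condMean Φ W a) ^ 2 =
        W a b * truncDensity Φ W a b ^ 2 - 2 * condMean Φ W a * (W a b * truncDensity Φ W a b) +
          W a b * condMean Φ W a ^ 2 := fun b => by ring
    rw [condVar]
    simp only [e, sum_add_distrib, sum_sub_distrib, ← mul_sum, ← sum_mul, (hW a).2]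
    have e2 : ∑ b, W a b * truncDensity Φ W a b = condMean Φ W a := rfl
    have e3 : condMean Φ W a = ∑ b, W a b * infoDensity Φ W a b := by
      simp only [condMean, truncDensity, if_pos h]
    rw [e2, e3]
    simp only [truncDensity, if_pos h]
    ring

/-- The expected number of atypical pairs of letters is at most of order `1 / n`. -/
lemma prodExp_atypical_le {W : X → Y → ℝ} (hW : IsChannel W) {n : ℕ} (hn : n ≠ 0)
    (x : Fin n → X) :
    prodExp (fun i => W (x i)) (fun y => ∑ a, ∑ b,
      if 2 * √(n * Real.log n) < |(jointCount x y a b : ℝ) - count x a * W a b| then 1 else 0) ≤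
      2 * Fintype.card X * Fintype.card Y / n := by
  have hnp : (0 : ℝ) < n := Nat.cast_pos.2 (Nat.pos_of_ne_zero hn)
  have hlog : 0 ≤ Real.log n := Real.log_natCast_nonneg n
  have h : ∀ a b, prodExp (fun i => W (x i)) (fun y =>
      if 2 * √(n * Real.log n) < |(jointCount x y a b : ℝ) - count x a * W a b| then 1 else 0) ≤
      2 / n := by
    intro a b
    -- With `l = √(log n / n)` the exponent is `log n - 2 log n`, so each pair contributes at most
    -- `2/n`.
    have := prodExp_abs_tail_le (p := fun i => W (x i))
      (ξ := fun i c => centeredIndicator W a b (x i) c) (fun i => hW (x i))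
      (fun i => sum_mul_centeredIndicator hW a b (x i))
      (fun i c => abs_centeredIndicator_le hW a b (x i) c) (l := √(Real.log n / n))
      (Real.sqrt_nonneg _)
      (Real.sqrt_le_iff.2 ⟨zero_le_one, by
        rw [one_pow, div_le_one hnp]; exact Real.log_le_self hnp.le⟩)
      (2 * √(n * Real.log n))
    simp only [sum_centeredIndicator] at this
    refine this.trans_eq ?_
    have e : √(Real.log n / n) * √(n * Real.log n) = Real.log n := by
      rw [← Real.sqrt_mul (by positivity)]
      have : Real.log n / n * (n * Real.log n) = Real.log n ^ 2 := by field_simp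
      rw [this, Real.sqrt_sq hlog]
    have e2 : (Fintype.card (Fin n) : ℝ) * √(Real.log n / n) ^ 2 -
        √(Real.log n / n) * (2 * √(n * Real.log n)) = -Real.log n := by
      rw [mul_left_comm, e, Real.sq_sqrt (by positivity), Fintype.card_fin,
        mul_div_cancel₀ _ hnp.ne']
      ring
    rw [e2, Real.exp_neg, Real.exp_log hnp]
    rfl
  rw [prodExp_sum]
  simp only [prodExp_sum]
  refine (sum_le_sum fun a _ => sum_le_sum fun b _ => h a b).trans_eq ?_
  simp only [sum_const, card_univ, nsmul_eq_mul]
  ring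

/-- The probability of a fall of the empirical mutual information is sandwiched between
normal tails. -/
lemma fallProb_bounds {W : X → Y → ℝ} (hW : IsChannel W) {Φ : X → ℝ}
    (hΦ : Φ ∈ stdSimplex ℝ X) (hV : 0 < condInfoVar Φ W) :
    ∃ (C : ℝ) (N : ℕ), 0 ≤ C ∧ ∀ n ≥ N, ∀ Φn ∈ nTypes X n, ‖Φ - Φn‖ ≤ 1 / (n : ℝ) →
      ∀ x ∈ typeClass n Φn, ∃ σ > 0, |σ ^ 2 - n * condInfoVar Φ W| ≤ C ∧ ∀ r,
        gaussianQ ((n * r + C * Real.log n) / σ) - C / √n ≤ fallProb W Φ Φn x r ∧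
        fallProb W Φ Φn x r ≤ gaussianQ ((n * r - C * Real.log n) / σ) + C / √n := by
  obtain ⟨C₁, N₁, hC₁⟩ := abs_mutualInfo_condType_sub_le hW hΦ
  set V := condInfoVar Φ W with hVdef
  set Cm := ∑ a, |condMean Φ W a| with hCm
  set Cv := ∑ a, |condVar Φ W a| with hCv
  set M := ∑ a, ∑ b, |truncDensity Φ W a b - condMean Φ W a| with hM
  have hCm0 : 0 ≤ Cm := sum_nonneg fun a _ => abs_nonneg _
  have hCv0 : 0 ≤ Cv := sum_nonneg fun a _ => abs_nonneg _
  have hM0 : 0 ≤ M := sum_nonneg fun a _ => sum_nonneg fun b _ => abs_nonneg _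
  have hMle : ∀ a b, |truncDensity Φ W a b - condMean Φ W a| ≤ M := fun a b =>
    (single_le_sum (f := fun b => |truncDensity Φ W a b - condMean Φ W a|)
      (fun i _ => abs_nonneg _) (mem_univ b)).trans
    (single_le_sum (f := fun a => ∑ b, |truncDensity Φ W a b - condMean Φ W a|)
      (fun i _ => sum_nonneg fun b _ => abs_nonneg _) (mem_univ a))
  have hB : 0 ≤ 40 + 2 * millsBound := by linarith [one_le_millsBound]
  set Cb := (40 + 2 * millsBound) * (M / √(V / 2)) with hCb
  have hCb0 : 0 ≤ Cb := by positivity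
  set k : ℝ := 2 * Fintype.card X * Fintype.card Y with hk
  have hk0 : 0 ≤ k := by positivity
  -- One constant for everything: linearization and mean (`C₁`, `Cm`), variance (`Cv`), Berry–Esseen
  -- (`Cb`) and atypical outputs (`k`).
  set C := |C₁| + Cm + Cv + Cb + k with hC
  have hC0 : 0 ≤ C := by positivity
  refine ⟨C, max (max N₁ 3) (max ⌈2 * Cv / V⌉₊ ⌈2 * M ^ 2 / V⌉₊), hC0,
    fun n hn Φn hΦn hΦΦn x hx => ?_⟩
  simp only [ge_iff_le, max_le_iff] at hn
  obtain ⟨⟨hnN, hn3⟩, hnv, hnM⟩ := hn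
  have hn0 : n ≠ 0 := by omega
  have hnp : (0 : ℝ) < n := by positivity
  have hn1 : (1 : ℝ) ≤ n := by exact_mod_cast (by omega : 1 ≤ n)
  have hlog : 1 ≤ Real.log n := by
    rw [Real.le_log_iff_exp_le hnp]
    exact Real.exp_one_lt_three.le.trans (by exact_mod_cast hn3)
  rw [Nat.ceil_le, div_le_iff₀ hV] at hnv hnM
  have hvar := abs_sum_comp_sub_le hn0 hΦΦn hx (condVar Φ W)
  rw [← condInfoVar_eq_sum_condVar hW hΦ, ← hCv, ← hVdef] at hvar
  have hmean := abs_sum_comp_sub_le hn0 hΦΦn hx (condMean Φ W)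
  rw [← mutualInfo_eq_sum_condMean hΦ, ← hCm] at hmean
  set s := ∑ i, condVar Φ W (x i) with hs
  have hsV : n * V / 2 ≤ s := by linarith [(abs_le.1 hvar).1]
  have hs0 : 0 < s := lt_of_lt_of_le (by positivity) hsV
  have hσ : 0 < √s := Real.sqrt_pos.2 hs0
  have hσ2 : √s ^ 2 = s := Real.sq_sqrt hs0.le
  refine ⟨√s, hσ, ?_, fun r => ?_⟩
  · rw [hσ2]
    refine hvar.trans ?_
    rw [hC]
    linarith [abs_nonneg C₁]
  set ξ : Fin n → Y → ℝ := fun i b => (truncDensity Φ W (x i) b - condMean Φ W (x i)) / √s with hξ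
  have hp : ∀ i, W (x i) ∈ stdSimplex ℝ Y := fun i => hW (x i)
  have h1 : ∀ i, ∑ b, W (x i) b * ξ i b = 0 := fun i => by
    simp only [hξ, mul_div_assoc', ← sum_div, mul_sub, sum_sub_distrib, ← sum_mul, (hp i).2]
    simp [condMean]
  have h2 : ∑ i, ∑ b, W (x i) b * ξ i b ^ 2 = 1 := by
    simp only [hξ, div_pow, mul_div_assoc', ← sum_div, hσ2]
    exact div_self hs0.ne'
  -- The threshold `2 M² / V` on `n` ensures that the standardized summands are bounded by one.
  have hMσ : M ≤ √s := Real.le_sqrt_of_sq_le (by linarith)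
  have hδ1 : M / √s ≤ 1 := (div_le_one hσ).2 hMσ
  have h3 : ∀ i b, |ξ i b| ≤ M / √s := fun i b => by
    simp only [hξ]
    rw [abs_div, abs_of_pos hσ]
    exact div_le_div_of_nonneg_right (hMle _ _) hσ.le
  have hBE := fun z => berry_esseen_bounded (p := fun i => W (x i)) hp h1 h2
    (div_nonneg hM0 hσ.le) hδ1 h3 z
  have hδ : (40 + 2 * millsBound) * (M / √s) + k / n ≤ C / √n := by
    have e1 : √n * √(V / 2) ≤ √s := by
      rw [← Real.sqrt_mul hnp.le]
      exact Real.sqrt_le_sqrt (by linarith)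
    have e2 : M / √s ≤ M / √(V / 2) / √n := by
      rw [div_div]
      refine div_le_div_of_nonneg_left hM0 (by positivity) ?_
      rwa [mul_comm]
    have e3 : k / n ≤ k / √n := by
      refine div_le_div_of_nonneg_left hk0 (by positivity) ?_
      exact (Real.sqrt_le_left hnp.le).2 (by nlinarith)
    calc _ ≤ (40 + 2 * millsBound) * (M / √(V / 2) / √n) + k / √n := by gcongr
      _ = (Cb + k) / √n := by rw [hCb]; ring
      _ ≤ C / √n := by
          refine div_le_div_of_nonneg_right ?_ (Real.sqrt_nonneg _)
          rw [hC]
          linarith [abs_nonneg C₁]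
  have hatyp := prodExp_atypical_le hW hn0 x
  have hsumξ : ∀ y : Fin n → Y, √s * ∑ i, ξ i (y i) =
      ∑ i, truncDensity Φ W (x i) (y i) - ∑ i, condMean Φ W (x i) := fun y => by
    simp only [hξ, ← sum_div, sum_sub_distrib]
    field_simp
  have hclose : ∀ y : Fin n → Y, (∀ i, 0 < W (x i) (y i)) →
      (∀ a b, |(jointCount x y a b : ℝ) - count x a * W a b| ≤ 2 * √(n * Real.log n)) →
      |n * mutualInfo Φn (condType x y) - n * mutualInfo Φ W - √s * ∑ i, ξ i (y i)| ≤
        C * Real.log n := fun y hy hty => by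
    have a1 := hC₁ n hnN Φn hΦn hΦΦn x hx y hy hty
    have a2 : C₁ * Real.log n ≤ |C₁| * Real.log n :=
      mul_le_mul_of_nonneg_right (le_abs_self _) (by linarith)
    have a3 : Cm ≤ Cm * Real.log n := le_mul_of_one_le_right hCm0 hlog
    have a4 : (|C₁| + Cm) * Real.log n ≤ C * Real.log n :=
      mul_le_mul_of_nonneg_right (by rw [hC]; linarith) (by linarith)
    rw [hsumξ]
    rw [abs_le] at a1 hmean ⊢
    constructor <;> linarith [a1.1, a1.2, hmean.1, hmean.2]
  have hA0 : ∀ y : Fin n → Y, 0 ≤ ∑ a, ∑ b,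
      if 2 * √(n * Real.log n) < |(jointCount x y a b : ℝ) - count x a * W a b| then (1 : ℝ)
        else 0 := fun y => sum_nonneg fun a _ => sum_nonneg fun b _ => by split_ifs <;> simp
  have hA1 : ∀ y : Fin n → Y, ¬ (∀ a b, |(jointCount x y a b : ℝ) - count x a * W a b| ≤
      2 * √(n * Real.log n)) → 1 ≤ ∑ a, ∑ b,
      if 2 * √(n * Real.log n) < |(jointCount x y a b : ℝ) - count x a * W a b| then (1 : ℝ)
        else 0 := fun y hy => by
    push Not at hy
    obtain ⟨a, b, hab⟩ := hy
    refine le_trans ?_ ((single_le_sum (f := fun b => if 2 * √(n * Real.log n) <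
      |(jointCount x y a b : ℝ) - count x a * W a b| then (1 : ℝ) else 0)
      (fun i _ => by split_ifs <;> simp) (mem_univ b)).trans
      (single_le_sum (f := fun a => ∑ b, if 2 * √(n * Real.log n) <
      |(jointCount x y a b : ℝ) - count x a * W a b| then (1 : ℝ) else 0)
      (fun i _ => sum_nonneg fun b _ => by split_ifs <;> simp) (mem_univ a)))
    exact (if_pos hab).ge
  rw [fallProb, outputProb_eq_prodExp]
  constructor
  · have hz := (abs_le.1 (hBE (-((n * r + C * Real.log n) / √s)))).1
    rw [neg_neg] at hz
    -- On typical outputs the normalized sum being this small forces the fall; atypical outputs are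
    -- paid for by their count, which is at least one.
    have hcomp : prodExp (fun i => W (x i)) (fun y =>
        if ∑ i, ξ i (y i) ≤ -((n * r + C * Real.log n) / √s) then 1 else 0) ≤
        prodExp (fun i => W (x i)) (fun y =>
          ({y | mutualInfo Φn (condType x y) ≤ mutualInfo Φ W - r}.indicator (fun _ => 1) y) +
          ∑ a, ∑ b, if 2 * √(n * Real.log n) <
            |(jointCount x y a b : ℝ) - count x a * W a b| then 1 else 0) := by
      refine prodExp_mono_of_pos hp fun y hy => ?_
      have hi : 0 ≤ {y | mutualInfo Φn (condType x y) ≤ mutualInfo Φ W - r}.indicator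
          (fun _ => (1 : ℝ)) y := Set.indicator_nonneg (fun _ _ => zero_le_one) _
      split_ifs with hS
      · by_cases hty : ∀ a b, |(jointCount x y a b : ℝ) - count x a * W a b| ≤
            2 * √(n * Real.log n)
        · rw [Set.indicator_of_mem]
          · linarith [hA0 y]
          · have b1 := (abs_le.1 (hclose y hy hty)).2
            rw [← neg_div, le_div_iff₀ hσ] at hS
            have b2 : n * mutualInfo Φn (condType x y) ≤ n * (mutualInfo Φ W - r) := by linarith
            exact le_of_mul_le_mul_left b2 hnp
        · linarith [hA1 y hty]
      · linarith [hA0 y]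
    rw [prodExp_add] at hcomp
    linarith
  · have hz := (abs_le.1 (hBE (-((n * r - C * Real.log n) / √s)))).2
    rw [neg_neg] at hz
    have hcomp : prodExp (fun i => W (x i))
        ({y | mutualInfo Φn (condType x y) ≤ mutualInfo Φ W - r}.indicator (fun _ => 1)) ≤
        prodExp (fun i => W (x i)) (fun y =>
          (if ∑ i, ξ i (y i) ≤ -((n * r - C * Real.log n) / √s) then 1 else 0) +
          ∑ a, ∑ b, if 2 * √(n * Real.log n) <
            |(jointCount x y a b : ℝ) - count x a * W a b| then 1 else 0) := by
      refine prodExp_mono_of_pos hp fun y hy => ?_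
      by_cases hE : y ∈ {y | mutualInfo Φn (condType x y) ≤ mutualInfo Φ W - r}
      · rw [Set.indicator_of_mem hE]
        by_cases hty : ∀ a b, |(jointCount x y a b : ℝ) - count x a * W a b| ≤
            2 * √(n * Real.log n)
        · rw [if_pos]
          · linarith [hA0 y]
          · have b1 := (abs_le.1 (hclose y hy hty)).1
            have b2 : n * mutualInfo Φn (condType x y) ≤ n * (mutualInfo Φ W - r) :=
              mul_le_mul_of_nonneg_left hE hnp.le
            rw [← neg_div, le_div_iff₀ hσ]
            linarith
        · refine le_add_of_nonneg_of_le ?_ (hA1 y hty)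
          split_ifs <;> simp
      · rw [Set.indicator_of_notMem hE]
        refine add_nonneg ?_ (hA0 y)
        split_ifs <;> simp
    rw [prodExp_add] at hcomp
    linarith

/-! ### Inversion -/

/-- The slope of `Q` is at least `m` in absolute value on `[z - 1, z + 1]`, and `h < m` keeps `h /
m` inside this window. Since `a` may lie outside, it is clamped there and monotonicity does the
rest. -/
lemma exists_gaussianQ_inversion (z : ℝ) : ∃ m > 0, ∀ a h, 0 ≤ h → h < m →
    (gaussianQ a ≤ gaussianQ z + h → z - h / m ≤ a) ∧
    (gaussianQ z - h ≤ gaussianQ a → a ≤ z + h / m) := by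
  obtain ⟨m, hm, H⟩ := gaussianQ_sub_le z
  refine ⟨m, hm, fun a h h0 hlt => ?_⟩
  have h1 : h / m < 1 := (div_lt_one hm).2 hlt
  have h2 : m * (h / m) = h := mul_div_cancel₀ _ hm.ne'
  have h3 : 0 ≤ h / m := div_nonneg h0 hm.le
  constructor
  · intro hQ
    by_contra! hc
    have e1 := H (max a (z - 1)) z (le_max_right _ _) (max_le (by linarith) (by linarith))
      (by linarith)
    have e2 := gaussianQ_antitone (le_max_left a (z - 1))
    have e3 : m * (h / m) < m * (z - max a (z - 1)) := by
      refine mul_lt_mul_of_pos_left ?_ hm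
      have : max a (z - 1) < z - h / m := max_lt hc (by linarith)
      linarith
    linarith
  · intro hQ
    by_contra! hc
    have e1 := H z (min a (z + 1)) (by linarith) (le_min (by linarith) (by linarith))
      (min_le_right _ _)
    have e2 := gaussianQ_antitone (min_le_left a (z + 1))
    have e3 : m * (h / m) < m * (min a (z + 1) - z) := by
      refine mul_lt_mul_of_pos_left ?_ hm
      have : z + h / m < min a (z + 1) := lt_min hc (by linarith)
      linarith
    linarith

lemma tendsto_log_div_sqrt :
    Filter.Tendsto (fun n : ℕ => Real.log n / √(n : ℝ)) Filter.atTop (nhds 0) := by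
  have h := (isLittleO_log_rpow_atTop (r := 1 / 2) (by norm_num)).tendsto_div_nhds_zero
  simp only [← Real.sqrt_eq_rpow] at h
  exact h.comp tendsto_natCast_atTop_atTop

/-- The values of `r` at which the probability of a fall crosses the level `ε + δ n`. -/
lemma fallProb_level {W : X → Y → ℝ} (hW : IsChannel W) {Φ : X → ℝ}
    (hΦ : Φ ∈ stdSimplex ℝ X) (hV : 0 < condInfoVar Φ W) {ε : ℝ} (hε : ε ∈ Set.Ioo (0 : ℝ) 1)
    {δ : ℕ → ℝ} (hδ : δ =O[Filter.atTop] (fun n : ℕ => Real.log n / √(n : ℝ))) :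
    ∃ (C : ℝ) (N : ℕ), ∀ n ≥ N, ∀ Φn ∈ nTypes X n, ‖Φ - Φn‖ ≤ 1 / (n : ℝ) →
      ∀ x ∈ typeClass n Φn, ∀ r,
        (fallProb W Φ Φn x r ≤ ε + δ n →
          √(condInfoVar Φ W / n) * gaussianQInv ε - C * (Real.log n / n) ≤ r) ∧
        (ε + δ n ≤ fallProb W Φ Φn x r →
          r ≤ √(condInfoVar Φ W / n) * gaussianQInv ε + C * (Real.log n / n)) := by
  obtain ⟨C, N₁, hC0, hC⟩ := fallProb_bounds hW hΦ hV
  obtain ⟨D, hD0, hD⟩ := hδ.exists_pos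
  rw [Asymptotics.isBigOWith_iff] at hD
  set V := condInfoVar Φ W with hVdef
  set z := gaussianQInv ε with hz
  have hQz : gaussianQ z = ε := gaussianQ_gaussianQInv hε
  obtain ⟨m, hm, hinv⟩ := exists_gaussianQ_inversion z
  have hlim : ∀ᶠ n : ℕ in Filter.atTop, (D + C) * (Real.log n / √(n : ℝ)) < m := by
    have := tendsto_log_div_sqrt.const_mul (D + C)
    rw [mul_zero] at this
    exact this.eventually (gt_mem_nhds hm)
  obtain ⟨N₂, hN₂⟩ := Filter.eventually_atTop.1 (hD.and hlim)
  have hsV : 0 < √V := Real.sqrt_pos.2 hV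
  -- The summands come from replacing `σ` by `√(nV)`, from the level error `h` scaled by `σ / m`,
  -- and from the `C log n` shift in the argument of `Q`.
  refine ⟨|z| * (C / √V) + (D + C) * (√V + C / √V) / m + C, max (max N₁ 3) N₂,
    fun n hn Φn hΦn hΦΦn x hx r => ?_⟩
  simp only [ge_iff_le, max_le_iff] at hn
  obtain ⟨⟨hnN, hn3⟩, hn2⟩ := hn
  have hnp : (0 : ℝ) < n := by positivity
  have hn1 : (1 : ℝ) ≤ n := by exact_mod_cast (by omega : 1 ≤ n)
  have hsn1 : 1 ≤ √(n : ℝ) := Real.one_le_sqrt.2 hn1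
  have hsn : 0 < √(n : ℝ) := by linarith
  have hlog : 1 ≤ Real.log n := by
    rw [Real.le_log_iff_exp_le hnp]
    exact Real.exp_one_lt_three.le.trans (by exact_mod_cast hn3)
  obtain ⟨hDn, hhm⟩ := hN₂ n hn2
  set L := Real.log n with hL
  -- Total level error: `D` bounds `δ n`, and `C` absorbs the `C / √n` of the normal approximation.
  set h := (D + C) * (L / √(n : ℝ)) with hh
  have hh0 : 0 ≤ h := by positivity
  rw [Real.norm_eq_abs, Real.norm_eq_abs, abs_of_nonneg (by positivity : 0 ≤ L / √(n : ℝ)),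
    abs_le] at hDn
  obtain ⟨σ, hσ, hσ2, hF⟩ := hC n hnN Φn hΦn hΦΦn x hx
  obtain ⟨hF1, hF2⟩ := hF r
  have hCn : C / √(n : ℝ) ≤ C * (L / √(n : ℝ)) := by
    rw [mul_div_assoc']
    exact div_le_div_of_nonneg_right (le_mul_of_one_le_right hC0 hlog) hsn.le
  have hhD : h = D * (L / √(n : ℝ)) + C * (L / √(n : ℝ)) := by rw [hh]; ring
  -- Factor `σ² - nV` and use `σ + √n √V ≥ √V`.
  have hsσ : |σ - √n * √V| ≤ C / √V := by
    rw [le_div_iff₀ hsV]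
    have e : σ ^ 2 - n * V = (σ - √n * √V) * (σ + √n * √V) := by
      ring_nf
      rw [Real.sq_sqrt hnp.le, Real.sq_sqrt hV.le]
    rw [e, abs_mul] at hσ2
    refine le_trans (mul_le_mul_of_nonneg_left ?_ (abs_nonneg _)) hσ2
    refine le_trans ?_ (le_abs_self _)
    nlinarith
  have hzσ : |z * σ - z * (√n * √V)| ≤ |z| * (C / √V) * L := by
    rw [← mul_sub, abs_mul]
    refine (mul_le_mul_of_nonneg_left hsσ (abs_nonneg z)).trans ?_
    exact le_mul_of_one_le_right (by positivity) hlog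
  have hhσ : h / m * σ ≤ (D + C) * (√V + C / √V) / m * L := by
    have e1 : σ ≤ √n * (√V + C / √V) := by
      have e2 : C / √V ≤ √n * (C / √V) := le_mul_of_one_le_left (by positivity) hsn1
      linarith [(abs_le.1 hsσ).2]
    refine (mul_le_mul_of_nonneg_left e1 (by positivity)).trans_eq ?_
    rw [hh]
    field_simp
  have hroot : √(V / n) = √n * √V / n := by
    rw [Real.sqrt_div hV.le]
    have : (n : ℝ) = √n * √n := (Real.mul_self_sqrt hnp.le).symm
    rw [div_eq_div_iff hsn.ne' hnp.ne']
    nth_rewrite 1 [this]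
    ring
  rw [hroot]
  have hzσ' := abs_le.1 hzσ
  constructor
  · intro hr
    have h1 := (hinv ((n * r + C * L) / σ) h hh0 hhm).1 (by rw [hQz]; linarith)
    rw [le_div_iff₀ hσ] at h1
    have h2 : z * (√n * √V) - (|z| * (C / √V) + (D + C) * (√V + C / √V) / m + C) * L ≤ n * r := by
      linarith
    have h3 := div_le_div_of_nonneg_right h2 hnp.le
    rw [mul_div_cancel_left₀ _ hnp.ne'] at h3
    refine le_trans (le_of_eq ?_) h3
    ring
  · intro hr
    have h1 := (hinv ((n * r - C * L) / σ) h hh0 hhm).2 (by rw [hQz]; linarith)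
    rw [div_le_iff₀ hσ] at h1
    have h2 : n * r ≤ z * (√n * √V) + (|z| * (C / √V) + (D + C) * (√V + C / √V) / m + C) * L := by
      linarith
    have h3 := div_le_div_of_nonneg_right h2 hnp.le
    rw [mul_div_cancel_left₀ _ hnp.ne'] at h3
    refine h3.trans (le_of_eq ?_)
    ring

/-- The expansion of the rate redundancy at the level `ε + δ n`. -/
lemma rateRedundancy_expansion {W : X → Y → ℝ} (hW : IsChannel W) {Φ : X → ℝ}
    (hΦ : Φ ∈ stdSimplex ℝ X) (hV : 0 < condInfoVar Φ W) {ε : ℝ} (hε : ε ∈ Set.Ioo (0 : ℝ) 1)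
    {δ : ℕ → ℝ} (hδ : δ =O[Filter.atTop] (fun n : ℕ => Real.log n / √(n : ℝ))) :
    ∃ (C : ℝ) (N : ℕ), ∀ n ≥ N, ∀ Φn ∈ nTypes X n, ‖Φ - Φn‖ ≤ 1 / (n : ℝ) →
      ∀ x ∈ typeClass n Φn,
        IsGLB {r | fallProb W Φ Φn x r ≤ ε + δ n} (rateRedundancy W Φ Φn x (ε + δ n)) ∧
        |rateRedundancy W Φ Φn x (ε + δ n) -
            √(condInfoVar Φ W / n) * gaussianQInv ε| ≤ C * (Real.log n / n) ∧
        ∀ r, fallProb W Φ Φn x r = ε + δ n →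
          |r - √(condInfoVar Φ W / n) * gaussianQInv ε| ≤ C * (Real.log n / n) := by
  obtain ⟨C, N, hC⟩ := fallProb_level hW hΦ hV hε hδ
  refine ⟨C, N, fun n hn Φn hΦn hΦΦn x hx => ?_⟩
  have H := hC n hn Φn hΦn hΦΦn x hx
  -- Contraposition of the upper crossing bound makes the level set contain a half line; with the
  -- lower bound, its `sInf` is a genuine infimum.
  have hmem : ∀ r, √(condInfoVar Φ W / n) * gaussianQInv ε + C * (Real.log n / n) < r →
      r ∈ {r | fallProb W Φ Φn x r ≤ ε + δ n} := fun r hr => by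
    by_contra hc
    exact absurd ((H r).2 (not_le.1 hc).le) (not_le.2 hr)
  have hlb : √(condInfoVar Φ W / n) * gaussianQInv ε - C * (Real.log n / n) ∈
      lowerBounds {r | fallProb W Φ Φn x r ≤ ε + δ n} := fun r hr => (H r).1 hr
  have hne : {r | fallProb W Φ Φn x r ≤ ε + δ n}.Nonempty := ⟨_, hmem _ (lt_add_one _)⟩
  have hglb : IsGLB {r | fallProb W Φ Φn x r ≤ ε + δ n} (rateRedundancy W Φ Φn x (ε + δ n)) :=
    Real.isGLB_sInf hne ⟨_, hlb⟩
  refine ⟨hglb, abs_le.2 ⟨?_, ?_⟩, fun r hr => abs_le.2 ⟨?_, ?_⟩⟩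
  · linarith [hglb.2 hlb]
  · have : rateRedundancy W Φ Φn x (ε + δ n) ≤
        √(condInfoVar Φ W / n) * gaussianQInv ε + C * (Real.log n / n) :=
      le_of_forall_gt_imp_ge_of_dense fun r hr => hglb.1 (hmem r hr)
    linarith
  · linarith [(H r).1 hr.le]
  · linarith [(H r).2 hr.ge]

end DMC

end

theorem mainTheorem5 {X Y : Type*} [Fintype X] [Fintype Y] [DecidableEq X] [DecidableEq Y]
    (W : X → Y → ℝ) (hW : DMC.IsChannel W)
    (Φ : X → ℝ) (hΦ : Φ ∈ stdSimplex ℝ X) (hV : 0 < DMC.condInfoVar Φ W)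
    (ε : ℝ) (hε : ε ∈ Set.Ioo (0 : ℝ) 1) :
    (∃ (C : ℝ) (N : ℕ), ∀ n ≥ N, ∀ Φn ∈ DMC.nTypes X n, ‖Φ - Φn‖ ≤ 1 / (n : ℝ) →
      ∀ x ∈ DMC.typeClass n Φn,
        IsGLB {r | DMC.fallProb W Φ Φn x r ≤ ε} (DMC.rateRedundancy W Φ Φn x ε) ∧
        |DMC.rateRedundancy W Φ Φn x ε -
            √(DMC.condInfoVar Φ W / n) * DMC.gaussianQInv ε| ≤ C * (Real.log n / n) ∧
        ∀ r, DMC.fallProb W Φ Φn x r = ε →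
          |r - √(DMC.condInfoVar Φ W / n) * DMC.gaussianQInv ε| ≤ C * (Real.log n / n)) ∧
    (∀ δ : ℕ → ℝ, δ =O[Filter.atTop] (fun n : ℕ => Real.log n / √(n : ℝ)) →
      ∃ (C : ℝ) (N : ℕ), ∀ n ≥ N, ∀ Φn ∈ DMC.nTypes X n, ‖Φ - Φn‖ ≤ 1 / (n : ℝ) →
      ∀ x ∈ DMC.typeClass n Φn,
        IsGLB {r | DMC.fallProb W Φ Φn x r ≤ ε + δ n}
          (DMC.rateRedundancy W Φ Φn x (ε + δ n)) ∧
        |DMC.rateRedundancy W Φ Φn x (ε + δ n) -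
            √(DMC.condInfoVar Φ W / n) * DMC.gaussianQInv ε| ≤ C * (Real.log n / n) ∧
        ∀ r, DMC.fallProb W Φ Φn x r = ε + δ n →
          |r - √(DMC.condInfoVar Φ W / n) * DMC.gaussianQInv ε| ≤ C * (Real.log n / n)) := by
  refine ⟨?_, fun δ hδ => DMC.rateRedundancy_expansion hW hΦ hV hε hδ⟩
  simpa only [add_zero] using DMC.rateRedundancy_expansion hW hΦ hV hε (δ := fun _ => 0)
    (Asymptotics.isBigO_zero _ _)
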